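/- Let $m\ge 1$, $n=2m-1$, let $V=\mathbb C^{2m}$ with standard basis $f_1,\dots,f_{2m}$ and $W=\mathbb C^{2n}$ with standard basis $e_1,\dots,e_{2n}$. Let $b_V$ be a non-degenerate skew-symmetric bilinear form on $V$ with $b_V(f_k,f_l)=0$ unless $l=k^*$, where $k^*=2m-1-k$ for $1\le k\le 2m-2$ and $\{2m-1,2m\}$ are interchanged by $*$. Let $b_W$ be the form on $W$ with $b_W(e_k,e_{2n+1-k})=1$ for $k\le n$, $=-1$ for $k>n$, and all other $b_W(e_k,e_l)=0$. Let $\mathbf d=(d_1<\dots<d_s)$ be integers with $1\le d_i\le 2m$ whose set is preserved by $d\mapsto 2m-d$. Let $\mathrm{pr}_{i,j}:V\to V$ kill $f_i,\dots,f_{j-1}$ and fix the other $f_k$. Let $\mathcal Fl^a_{\mathbf d}\subset\prod_l \mathrm{Gr}_{d_l}(V)$ be the set of $(V_1,\dots,V_s)$ with $\mathrm{pr}_{d_l,d_{l+1}}(V_l)\subset V_{l+1}$ for $1\le l<s$. Let $\iota$ denote both maps $(U_1,\dots,U_s)\mapsto(U_s^\perp,\dots,U_1^\perp)$, on $\prod_l\mathrm{Gr}_{d_l}(V)$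 (with respect to $b_V$) and on $\prod_l\mathrm{Gr}_{2d_l-1}(W)$ (with respect to $b_W$). The partial symplectic degenerate flag variety is the fixed locus $\mathrm{Sp}\mathcal F^a_{\mathbf d}:=(\mathcal Fl^a_{\mathbf d})^\iota$. Let $\mathrm{Sp}_{2n}\subset \mathrm{SL}_{2n}$ be the group preserving $b_W$, let $B$ and $T$ be the upper triangular and the diagonal matrices in $\mathrm{SL}_{2n}$, and $B^\iota=B\cap\mathrm{Sp}_{2n}$, $T^\iota=T\cap\mathrm{Sp}_{2n}$. Let $P$ be the stabilizer in $\mathrm{SL}_{2n}$ of the flag with subspaces $\langle e_1,\dots,e_{2d_l-1}\rangle$, so that $\mathrm{SL}_{2n}/P$ is the variety of flags $W_1\subset\dots\subset W_s$ in $W$ with $\dim W_l=2d_l-1$, and let $Q=P\cap\mathrm{Sp}_{2n}$; identify $\mathrm{Sp}_{2n}/Q$ with the $\mathrm{Sp}_{2n}$-orbit of that flag. A permutation $\tau$ of $\{1,\dots,2n\}$ gives the flag $p_\tau$ with subspaces $\langle e_{\tau(1)},\dots,e_{\tau(2d_l-1)}\rangle$. Put $d_0=0$, $d_{s+1}=n+1$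 and let $\sigma_{\mathbf d}$ be the permutation of $\{1,\dots,2n\}$ with $$\sigma_{\mathbf d}(k)=\begin{cases}k-d_i & \text{if } 2d_i\le k\le d_i+d_{i+1}-1,\\ n+1+k-d_{i+1} & \text{if } d_i+d_{i+1}\le k\le 2d_{i+1}-1\end{cases}\qquad(0\le i\le s).$$ Let $X_{\sigma_{\mathbf d}}=\overline{B\,p_{\sigma_{\mathbf d}}}\subset \mathrm{SL}_{2n}/P$ be the Schubert variety and $X_{\sigma_{\mathbf d}}^\iota$ the set of its $\iota$-fixed points. An element $t=\mathrm{diag}(\lambda_1,\dots,\lambda_{2n})\in T$ acts on $\prod_l\mathrm{Gr}_{2d_l-1}(W)$ by $e_k\mapsto\lambda_ke_k$, and on $\prod_l\mathrm{Gr}_{d_l}(V)$ through the action on the $l$-th copy of $V$ given by $f_k\mapsto\lambda_kf_k$ for $d_l\le k\le n+1$ and $f_k\mapsto\lambda_{n+1+k}f_k$ for $1\le k\le d_l-1$. Then $\mathrm{Sp}\mathcal F^a_{\mathbf d}$ and $X_{\sigma_{\mathbf d}}^\iota$ are Zariski closed (so projective varieties), $X_{\sigma_{\mathbf d}}^\iota$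 is the Schubert variety $\overline{B^\iota p_{\sigma_{\mathbf d}}}$ of $\mathrm{Sp}_{2n}/Q$, $T^\iota$ preserves $\mathrm{Sp}\mathcal F^a_{\mathbf d}$, and there exists a $T^\iota$-equivariant isomorphism of projective varieties $$\zeta:\ \mathrm{Sp}\mathcal F^a_{\mathbf d}\ \xrightarrow{\ \simeq\ }\ X_{\sigma_{\mathbf d}}^\iota\subset \mathrm{Sp}_{2n}/Q.$$ -/

import Mathlib

noncomputable section

namespace DegFlag

/-! ### Products of Grassmannians as projective varieties

All varieties are over `ℂ` and are classical (reduced) varieties, given by their points. A point of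
a product of Grassmannians of `ℂ ^ N` is a tuple of subspaces. The product is embedded in a product
of projective spaces by the Plücker coordinates of its factors. -/

/-- Tuples of subspaces of `ℂ ^ N`, indexed by `Fin s`. -/
abbrev Tuple (s N : ℕ) : Type := Fin s → Submodule ℂ (Fin N → ℂ)

/-- The product of the Grassmannians of `e l`-dimensional subspaces of `ℂ ^ N`. -/
def multiGr {s : ℕ} (N : ℕ) (e : Fin s → ℕ) : Set (Tuple s N) :=
  {x | ∀ l, Module.finrank ℂ (x l) = e l}

/-- `q` is a vector of homogeneous Plücker coordinates of the `k`-dimensional subspace `U`: up to a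
nonzero scalar, its entries are the maximal minors of a matrix whose rows are a basis of `U`. -/
def IsPlucker {N k : ℕ} (U : Submodule ℂ (Fin N → ℂ)) (q : (Fin k ↪o Fin N) → ℂ) : Prop :=
  ∃ A : Matrix (Fin k) (Fin N) ℂ,
    LinearIndependent ℂ (fun i => A i) ∧ Submodule.span ℂ (Set.range fun i => A i) = U ∧
      ∃ c : ℂ, c ≠ 0 ∧ ∀ I, q I = c * (A.submatrix id I).det

/-- The index set of all Plücker coordinates on a product of Grassmannians. -/
abbrev PluckerIndex {s : ℕ} (N : ℕ) (e : Fin s → ℕ) : Type := Σ l : Fin s, (Fin (e l) ↪o Fin N)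

/-- `p` collects homogeneous Plücker coordinates of every entry of the tuple `x`. -/
def IsMultiPlucker {s N : ℕ} (e : Fin s → ℕ) (x : Tuple s N) (p : PluckerIndex N e → ℂ) : Prop :=
  ∀ l, IsPlucker (x l) (fun I => p ⟨l, I⟩)

/-- `F` is multihomogeneous of multidegree `δ`: of degree `δ l` in the Plücker coordinates of the
`l`-th factor. -/
def IsMultihomogeneous {s N : ℕ} {e : Fin s → ℕ} (F : MvPolynomial (PluckerIndex N e) ℂ)
    (δ : Fin s → ℕ) : Prop :=
  MvPolynomial.IsWeightedHomogeneous
    (fun c : PluckerIndex N e => (Pi.single c.1 1 : Fin s → ℕ)) F δ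

/-- The polynomial `F` in the Plücker coordinates vanishes at the point `x`. -/
def VanishesAt {s N : ℕ} {e : Fin s → ℕ} (F : MvPolynomial (PluckerIndex N e) ℂ)
    (x : Tuple s N) : Prop :=
  ∀ p, IsMultiPlucker e x p → MvPolynomial.eval p F = 0

/-- The Zariski closure of `A` in the product of Grassmannians `multiGr N e`. -/
def zariskiClosure {s N : ℕ} (e : Fin s → ℕ) (A : Set (Tuple s N)) : Set (Tuple s N) :=
  {x | x ∈ multiGr N e ∧
    ∀ (F : MvPolynomial (PluckerIndex N e) ℂ) (δ : Fin s → ℕ), IsMultihomogeneous F δ →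
      (∀ a ∈ A, VanishesAt F a) → VanishesAt F x}

/-- `X` is a closed subvariety of the product of Grassmannians `multiGr N e`. -/
def IsZariskiClosed {s N : ℕ} (e : Fin s → ℕ) (X : Set (Tuple s N)) : Prop :=
  zariskiClosure e X = X

/-- `φ` is a regular map from `X ⊆ multiGr N e` to `multiGr N' e'`: near every point `x` of `X`, the
Plücker coordinates of each entry of `φ` are given by multihomogeneous polynomials of one common
multidegree in the Plücker coordinates of the source, not all vanishing at `x`. (The polynomials
describe `φ` wherever they do not all vanish; multiplying by a further form shrinks any open
neighbourhood of `x` to one of this kind.) -/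
def IsRegularMap {s s' N N' : ℕ} (e : Fin s → ℕ) (e' : Fin s' → ℕ) (X : Set (Tuple s N))
    (φ : X → Tuple s' N') : Prop :=
  ∀ (x : X) (l : Fin s'),
    ∃ (δ : Fin s → ℕ) (F : (Fin (e' l) ↪o Fin N') → MvPolynomial (PluckerIndex N e) ℂ),
      (∀ I, IsMultihomogeneous (F I) δ) ∧
      (∃ I, ¬ VanishesAt (F I) x.1) ∧
      ∀ (y : X) (p : PluckerIndex N e → ℂ), IsMultiPlucker e y.1 p →
        (∃ I, MvPolynomial.eval p (F I) ≠ 0) →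
          IsPlucker (φ y l) (fun I => MvPolynomial.eval p (F I))

/-- The bijection `ζ` is an isomorphism of varieties `X ≃ Y`. -/
def IsVarietyIso {s s' N N' : ℕ} (e : Fin s → ℕ) (e' : Fin s' → ℕ) {X : Set (Tuple s N)}
    {Y : Set (Tuple s' N')} (ζ : X ≃ Y) : Prop :=
  IsRegularMap e e' X (fun x => (ζ x).1) ∧ IsRegularMap e' e Y (fun y => (ζ.symm y).1)

/-- The involution `ι`, which sends a tuple `(U₁, …, Uₛ)` to `(Uₛ^⊥, …, U₁^⊥)`. For dimensions
`e₁ < ⋯ < eₛ` that are symmetric under `e ↦ N - e` it is the product of the maps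
`Gr_e → Gr_{N-e}, U ↦ U^⊥`. -/
def iota {s N : ℕ} (b : LinearMap.BilinForm ℂ (Fin N → ℂ)) (x : Tuple s N) : Tuple s N :=
  fun l => b.orthogonal (x (Fin.rev l))

/-! ### Degenerate flag varieties

`V = ℂ ^ (n + 1)` with basis `f₁, …, f_{n+1}`; the vector `f_k` is `Pi.single (k - 1) 1`, so the
element `k : Fin (n + 1)` carries the label `k + 1`. The same convention is used for the basis
`e₁, …, e_{2n}` of `W = ℂ ^ (2n)`. -/

/-- `pr_{i,j} = pr_{j-1} ∘ ⋯ ∘ pr_i`, where `pr_k` is the projection of `V` along `f_k`: it kills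
`f_i, …, f_{j-1}` and fixes the other basis vectors. -/
def pr (n i j : ℕ) : (Fin (n + 1) → ℂ) →ₗ[ℂ] (Fin (n + 1) → ℂ) :=
  Matrix.toLin' (Matrix.diagonal fun k : Fin (n + 1) =>
    if i ≤ (k : ℕ) + 1 ∧ (k : ℕ) + 1 < j then (0 : ℂ) else 1)

/-- The partial degenerate flag variety of type A with dimension vector `d`. -/
def degFlag {s : ℕ} (n : ℕ) (d : Fin s → ℕ) : Set (Tuple s (n + 1)) :=
  {x | x ∈ multiGr (n + 1) d ∧
    ∀ l l' : Fin s, (l : ℕ) + 1 = l' → (x l).map (pr n (d l) (d l')) ≤ x l'}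

/-- The label of the dual vector: `f_k^*` is a multiple of `f_{dualLabel n k}`. -/
def dualLabel (n k : ℕ) : ℕ :=
  if k < n then n - k else if k = n then n + 1 else n

/-- `b` is a non-degenerate skew-symmetric form on `V` for which the basis vector dual to `f_k` is,
up to a scalar, `f_{n-k}` for `1 ≤ k ≤ n - 1`, and `f_n`, `f_{n+1}` are dual to each other. -/
structure IsSymplecticV (n : ℕ) (b : LinearMap.BilinForm ℂ (Fin (n + 1) → ℂ)) : Prop where
  alt : b.IsAlt
  nondegenerate : b.Nondegenerate
  dual : ∀ k l : Fin (n + 1), (l : ℕ) + 1 ≠ dualLabel n (k + 1) →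
    b (Pi.single k 1) (Pi.single l 1) = 0

/-- The partial symplectic degenerate flag variety: the `ι`-fixed points of `degFlag`. -/
def spDegFlag {s : ℕ} (n : ℕ) (b : LinearMap.BilinForm ℂ (Fin (n + 1) → ℂ)) (d : Fin s → ℕ) :
    Set (Tuple s (n + 1)) :=
  {x | x ∈ degFlag n d ∧ iota b x = x}

/-! ### The symplectic group, flag varieties and Schubert varieties -/

/-- The matrix of the symplectic form on `W`, with blocks `0, J, -J, 0`, where `J` is the `n × n`
antidiagonal matrix with entries `1`. -/
def formMatrix (n : ℕ) : Matrix (Fin (2 * n)) (Fin (2 * n)) ℂ :=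
  Matrix.of fun i j =>
    if (i : ℕ) + j + 1 = 2 * n then (if (i : ℕ) < n then 1 else -1) else 0

/-- The symplectic form on `W`. -/
def formW (n : ℕ) : LinearMap.BilinForm ℂ (Fin (2 * n) → ℂ) :=
  Matrix.toBilin' (formMatrix n)

/-- `SL_{2n}(ℂ)`. -/
abbrev SL (n : ℕ) : Type := Matrix.SpecialLinearGroup (Fin (2 * n)) ℂ

/-- The Borel subgroup `B` of upper triangular matrices of `SL_{2n}`. -/
def borel (n : ℕ) : Set (SL n) := {g | ∀ i j, j < i → g.1 i j = 0}

/-- The maximal torus `T` of diagonal matrices of `SL_{2n}`. -/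
def torus (n : ℕ) : Set (SL n) := {g | ∀ i j, i ≠ j → g.1 i j = 0}

/-- `Sp_{2n}`: the elements of `SL_{2n}` that preserve the symplectic form on `W`. Intersecting with
it gives `B^ι` and `T^ι`. -/
def symplectic (n : ℕ) : Set (SL n) :=
  {g | ∀ v w, formW n (g.1.mulVec v) (g.1.mulVec w) = formW n v w}

/-- The action of `SL_{2n}` on tuples of subspaces of `W`. -/
def act {s n : ℕ} (g : SL n) (x : Tuple s (2 * n)) : Tuple s (2 * n) :=
  fun l => (x l).map (Matrix.toLin' g.1)

/-- The orbit of `x` under a subset (in practice, a subgroup) of `SL_{2n}`. -/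
def orbitOf {s n : ℕ} (G : Set (SL n)) (x : Tuple s (2 * n)) : Set (Tuple s (2 * n)) :=
  {y | ∃ g ∈ G, y = act g x}

/-- The dimensions `2 d_l - 1` of the subspaces in the flags that make up `SL_{2n} / P_λ`, where
`λ = ∑ ω_{2 d_l - 1}`. -/
def flagDim {s : ℕ} (d : Fin s → ℕ) : Fin s → ℕ := fun l => 2 * d l - 1

/-- The torus-fixed point `τ P_λ` of the flag variety: the flag whose `l`-th subspace is spanned by
`e_{τ(1)}, …, e_{τ(2 d_l - 1)}`. Here `τ` acts on the labels `1, …, 2n`. -/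
def coordFlag {s : ℕ} (n : ℕ) (d : Fin s → ℕ) (τ : ℕ → ℕ) : Tuple s (2 * n) :=
  fun l => Submodule.span ℂ
    {v | ∃ (r : ℕ) (k : Fin (2 * n)), 1 ≤ r ∧ r ≤ flagDim d l ∧ τ r = (k : ℕ) + 1 ∧
      v = Pi.single k 1}

/-- `SL_{2n} / P_λ`, as the `SL_{2n}`-orbit of the standard flag, whose stabilizer is `P_λ`. -/
def slFlagVariety {s : ℕ} (n : ℕ) (d : Fin s → ℕ) : Set (Tuple s (2 * n)) :=
  orbitOf Set.univ (coordFlag n d id)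

/-- `Sp_{2n} / Q`, as the `Sp_{2n}`-orbit of the standard flag, whose stabilizer in `Sp_{2n}` is
`Q = P_λ ∩ Sp_{2n}`. -/
def spFlagVariety {s : ℕ} (n : ℕ) (d : Fin s → ℕ) : Set (Tuple s (2 * n)) :=
  orbitOf (symplectic n) (coordFlag n d id)

/-- The Schubert variety `X_τ`: the closure of `B τ P_λ / P_λ` in `SL_{2n} / P_λ`. -/
def schubertSL {s : ℕ} (n : ℕ) (d : Fin s → ℕ) (τ : ℕ → ℕ) : Set (Tuple s (2 * n)) :=
  slFlagVariety n d ∩ zariskiClosure (flagDim d) (orbitOf (borel n) (coordFlag n d τ))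

/-- The Schubert variety of `Sp_{2n} / Q` at `τ`: the closure of `B^ι τ Q / Q` in `Sp_{2n} / Q`. -/
def schubertSp {s : ℕ} (n : ℕ) (d : Fin s → ℕ) (τ : ℕ → ℕ) : Set (Tuple s (2 * n)) :=
  spFlagVariety n d ∩
    zariskiClosure (flagDim d) (orbitOf (borel n ∩ symplectic n) (coordFlag n d τ))

/-- The `ι`-fixed points `X_τ^ι` of the Schubert variety `X_τ`. -/
def schubertFixed {s : ℕ} (n : ℕ) (d : Fin s → ℕ) (τ : ℕ → ℕ) : Set (Tuple s (2 * n)) :=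
  {x | x ∈ schubertSL n d τ ∧ iota (formW n) x = x}

/-- The sequence `d_0 = 0, d_1, …, d_s, d_{s+1} = n + 1`. -/
def extDim {s : ℕ} (n : ℕ) (d : Fin s → ℕ) (i : ℕ) : ℕ :=
  if i = 0 then 0 else if h : i - 1 < s then d ⟨i - 1, h⟩ else n + 1

/-- The index `i` of the block `2 d_i ≤ k ≤ 2 d_{i+1} - 1` that contains `k`: the number of `l` with
`2 d_l ≤ k`. -/
def blockIndex {s : ℕ} (d : Fin s → ℕ) (k : ℕ) : ℕ :=
  (Finset.univ.filter fun l : Fin s => 2 * d l ≤ k).card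

/-- The permutation `σ_d` of `{1, …, 2n}`: with `i` the block of `k`, it is `k - d_i` for
`2 d_i ≤ k ≤ d_i + d_{i+1} - 1` and `n + 1 + k - d_{i+1}` for
`d_i + d_{i+1} ≤ k ≤ 2 d_{i+1} - 1`. -/
def sigma {s : ℕ} (n : ℕ) (d : Fin s → ℕ) (k : ℕ) : ℕ :=
  if k < extDim n d (blockIndex d k) + extDim n d (blockIndex d k + 1) then
    k - extDim n d (blockIndex d k)
  else n + 1 + k - extDim n d (blockIndex d k + 1)

/-! ### The torus action on the degenerate flag variety -/

/-- The diagonal entry `λ_r` of `t`, for a label `1 ≤ r ≤ 2n` (and `1` for other `r`). -/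
def diagEntry {n : ℕ} (t : SL n) (r : ℕ) : ℂ :=
  if h : r - 1 < 2 * n ∧ 1 ≤ r then t.1 ⟨r - 1, h.1⟩ ⟨r - 1, h.1⟩ else 1

/-- The action of `T` on the `i`-th copy of `V`: `f_k` is multiplied by `λ_k` for `i ≤ k ≤ n + 1`
and by `λ_{n+1+k}` for `1 ≤ k ≤ i - 1`. -/
def torusOnV {n : ℕ} (t : SL n) (i : ℕ) : (Fin (n + 1) → ℂ) →ₗ[ℂ] (Fin (n + 1) → ℂ) :=
  Matrix.toLin' (Matrix.diagonal fun k : Fin (n + 1) =>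
    if i ≤ (k : ℕ) + 1 then diagEntry t (k + 1) else diagEntry t (n + 1 + (k + 1)))

/-- The induced action of `T` on tuples of subspaces of `V` of dimensions `d`. -/
def torusAct {s n : ℕ} (d : Fin s → ℕ) (t : SL n) (x : Tuple s (n + 1)) : Tuple s (n + 1) :=
  fun l => (x l).map (torusOnV t (d l))

end DegFlag

end

noncomputable section

namespace DegFlag

/-! ### Alternating forms and maximal minors -/

/-! Write `F_j` for the span of `e_1, …, e_j` in `W`. The copy of `V` at `d` is a model of the
subquotient `F_{n+d} / F_{d-1}`: `f_k` goes to a multiple of `e_k` if `k ≥ d` and of `e_{n+1+k}` if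
`k < d`. In this model `pr_{d,d'}` is the map induced by the inclusion `F_{n+d} ⊆ F_{n+d'}`
(`extendSub_le_extendSub_iff`). If `d + d' = n + 1`, then `F_{d-1}` and `F_{n+d'}` are orthogonal
complements, so the form on `W` pairs the subquotients at `d` and `d'`; after rescaling the basis
vectors this pairing is `b` (`formW_embed`, `orthogonal_extendSub`).

Hence taking preimages, `V_l ↦ F_{d_l-1} ⊕ V_l`, identifies the symplectic degenerate flag variety
with `boundedFlags`, the `ι`-fixed flags with `W_l ⊆ F_{n+d_l}`; the lower bound `F_{d_l-1} ⊆ W_l`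
is the orthogonal of the upper one. Both directions are linear in Plücker coordinates
(`Splitting.exists_forms_extend`, `Splitting.exists_forms_of_extend`), and the torus weights agree
by construction.

It remains to see that `boundedFlags` is the Schubert variety, through the cycle `schubertFixed ⊆
boundedFlags ⊆ schubertSp ⊆ schubertFixed`. The first inclusion holds because the bounds are closed
and stable under `B`, and the last is formal. For the middle one, a symplectic Gram–Schmidt process
writes an `ι`-fixed flag as a `B^ι`-translate of a symmetric coordinate flag
(`exists_eq_act_levelFlag`). If the coordinate flag satisfies the bounds but is not that of `σ_d`, a
suitable reflection keeps the bounds and lowers a weight (`exists_reflection`, `reflection_low`). A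
root subgroup gives a curve through the old flag whose other points lie in the `B^ι`-orbit of the
reflected one (`exists_map_rootMap_levelFlag`), so the old flag lies in the closure
(`vanishesAt_of_curve`), and induction finishes.

Closedness on both sides is reduced to one statement: orthogonality of two members of a tuple for a
fixed bilinear form is a closed condition (`bilin_eq_zero_of_mem_zariskiClosure`). -/

/-- The minor of the columns `J`, as an alternating form in the rows. -/
def minorForm {N k : ℕ} (J : Fin k ↪o Fin N) : (Fin N → ℂ) [⋀^Fin k]→ₗ[ℂ] ℂ :=
  Matrix.detRowAlternating.compLinearMap (LinearMap.funLeft ℂ ℂ J)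

/-- The minors are dual to the increasing tuples of basis vectors: if `J ≠ g`, some `g i` is not a
column of `J`, and row `i` of the minor vanishes. -/
theorem minorForm_single {N k : ℕ} (J g : Fin k ↪o Fin N) :
    minorForm J (fun i => Pi.single (g i) 1) = if J = g then 1 else 0 := by
  have hdet : minorForm J (fun i => Pi.single (g i) 1) =
      Matrix.det (Matrix.of fun i j => (Pi.single (g i) (1 : ℂ) : Fin N → ℂ) (J j)) := rfl
  rw [hdet]
  split_ifs with h
  · subst h
    convert Matrix.det_one (R := ℂ) (n := Fin k)
    ext i j
    simp [Pi.single_apply, Matrix.one_apply, eq_comm]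
  · have : ∃ i, g i ∉ Set.range J := by
      by_contra! hc
      apply h
      have hsub : Set.range g ⊆ Set.range J := by rintro _ ⟨i, rfl⟩; exact hc i
      have heq : Set.range g = Set.range J := by
        apply Set.eq_of_subset_of_ncard_le hsub
        rw [← Set.image_univ, ← Set.image_univ, Set.ncard_image_of_injective _ g.injective,
          Set.ncard_image_of_injective _ J.injective]
      exact (OrderEmbedding.range_inj.1 heq).symm
    obtain ⟨i, hi⟩ := this
    apply Matrix.det_eq_zero_of_row_eq_zero i
    intro j
    simp only [Matrix.of_apply]
    exact Pi.single_eq_of_ne (fun h' => hi ⟨j, h'⟩) _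

theorem alternatingMap_sum_apply {ι : Type*} (t : Finset ι) {N k : ℕ}
    (f : ι → (Fin N → ℂ) [⋀^Fin k]→ₗ[ℂ] ℂ) (v : Fin k → Fin N → ℂ) :
    (∑ i ∈ t, f i) v = ∑ i ∈ t, f i v := by
  classical
  induction t using Finset.induction_on with
  | empty => simp
  | insert a t ha ih =>
    rw [Finset.sum_insert ha, Finset.sum_insert ha, AlternatingMap.add_apply, ih]

/-- An alternating form in `k` vectors is a linear combination of the `k × k` minors. -/
theorem alternatingMap_eq_sum_minors {N k : ℕ} (ω : (Fin N → ℂ) [⋀^Fin k]→ₗ[ℂ] ℂ)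
    (A : Matrix (Fin k) (Fin N) ℂ) :
    ω (fun i => A i) =
      ∑ J : Fin k ↪o Fin N, ω (fun i => Pi.single (J i) 1) * (A.submatrix id J).det := by
  have key : ω = ∑ J : Fin k ↪o Fin N, ω (fun i => Pi.single (J i) 1) • minorForm J := by
    refine Module.Basis.ext_alternating (Pi.basisFun ℂ (Fin N)) fun v hv => ?_
    set ω' := ∑ J : Fin k ↪o Fin N, ω (fun i => Pi.single (J i) 1) • minorForm J with hω'
    -- Sorting `v` introduces the same sign on both sides, so increasing tuples suffice; there only
    -- the minor `J = g` survives.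
    have hmono : StrictMono (v ∘ Tuple.sort v) :=
      (Tuple.monotone_sort v).strictMono_of_injective (hv.comp (Tuple.sort v).injective)
    let g : Fin k ↪o Fin N := OrderEmbedding.ofStrictMono _ hmono
    have hg : ω (fun i => Pi.single (g i) 1) = ω' (fun i => Pi.single (g i) 1) := by
      rw [hω', alternatingMap_sum_apply]
      simp only [AlternatingMap.smul_apply, minorForm_single, smul_eq_mul, mul_ite, mul_one,
        mul_zero, Finset.sum_ite_eq', Finset.mem_univ, if_true]
    have e1 := ω.map_perm (fun i => Pi.single (v i) 1) (Tuple.sort v)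
    have e2 := ω'.map_perm (fun i => Pi.single (v i) 1) (Tuple.sort v)
    have e3 : (fun i => Pi.single (v i) (1 : ℂ)) ∘ Tuple.sort v =
      fun i => (Pi.single (g i) 1 : Fin N → ℂ) := rfl
    rw [e3] at e1 e2
    have := e1.symm.trans (hg.trans e2)
    simpa using this
  conv_lhs => rw [key]
  rw [alternatingMap_sum_apply]
  rfl

/-- The alternating form `A ↦ det (A * G)`. -/
def detMulForm {N k : ℕ} (G : Matrix (Fin N) (Fin k) ℂ) : (Fin N → ℂ) [⋀^Fin k]→ₗ[ℂ] ℂ :=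
  Matrix.detRowAlternating.compLinearMap (Matrix.vecMulLinear G)

theorem detMulForm_apply {N k : ℕ} (G : Matrix (Fin N) (Fin k) ℂ)
    (A : Matrix (Fin k) (Fin N) ℂ) : detMulForm G (fun i => A i) = (A * G).det := rfl

/-- Independent rows make `v ↦ v A` injective, and a left inverse of this map, written as a matrix
acting on row vectors, is `G`. -/
theorem exists_mul_eq_one {N k : ℕ} {A : Matrix (Fin k) (Fin N) ℂ}
    (hA : LinearIndependent ℂ (fun i => A i)) : ∃ G : Matrix (Fin N) (Fin k) ℂ, A * G = 1 := by
  have hinj : Function.Injective (Matrix.vecMulLinear A) := by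
    rw [Matrix.coe_vecMulLinear]; exact Matrix.vecMul_injective_iff.2 hA
  obtain ⟨g, hg⟩ := LinearMap.exists_leftInverse_of_injective (Matrix.vecMulLinear A)
    (LinearMap.ker_eq_bot.2 hinj)
  refine ⟨LinearMap.toMatrix' g |>.transpose, ?_⟩
  rw [← Matrix.transpose_inj, Matrix.transpose_mul, Matrix.transpose_transpose]
  apply Matrix.toLin'.injective
  rw [Matrix.toLin'_mul, Matrix.toLin'_toMatrix', Matrix.transpose_one, Matrix.toLin'_one, ← hg]
  congr 1
  ext v
  simp

/-- With a right inverse `G`, the number `det (A * G) = 1` is a linear combination of the minors of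
`A`. -/
theorem exists_minor_ne_zero {N k : ℕ} {A : Matrix (Fin k) (Fin N) ℂ}
    (hA : LinearIndependent ℂ (fun i => A i)) :
    ∃ J : Fin k ↪o Fin N, (A.submatrix id J).det ≠ 0 := by
  by_contra! hc
  obtain ⟨G, hG⟩ := exists_mul_eq_one hA
  have := alternatingMap_eq_sum_minors (detMulForm G) A
  rw [detMulForm_apply, hG, Matrix.det_one] at this
  simp [hc] at this

/-- Every subspace of dimension `k` is the row space of a matrix with independent rows. -/
theorem exists_rows {N k : ℕ} {U : Submodule ℂ (Fin N → ℂ)} (hU : Module.finrank ℂ U = k) :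
    ∃ A : Matrix (Fin k) (Fin N) ℂ,
      LinearIndependent ℂ (fun i => A i) ∧ Submodule.span ℂ (Set.range fun i => A i) = U := by
  let B := Module.finBasisOfFinrankEq ℂ U hU
  refine ⟨Matrix.of fun i => (B i : Fin N → ℂ), ?_, ?_⟩
  · exact B.linearIndependent.map' U.subtype (Submodule.ker_subtype U)
  · have : (Set.range fun i => Matrix.of (fun i => (B i : Fin N → ℂ)) i) =
        U.subtype '' Set.range B := by
      rw [← Set.range_comp]; rfl
    rw [this, Submodule.span_image, B.span_eq, Submodule.map_top, Submodule.range_subtype]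

/-- Two matrices with independent rows and equal row spaces differ by an invertible matrix. -/
theorem exists_eq_mul_of_span_eq {N k : ℕ} {A B : Matrix (Fin k) (Fin N) ℂ}
    (hA : LinearIndependent ℂ (fun i => A i))
    (h : Submodule.span ℂ (Set.range fun i => A i) = Submodule.span ℂ (Set.range fun i => B i)) :
    ∃ H : Matrix (Fin k) (Fin k) ℂ, H.det ≠ 0 ∧ A = H * B := by
  have hmem : ∀ i, ∃ c : Fin k → ℂ, ∑ j, c j • B j = A i := by
    intro i
    have : A i ∈ Submodule.span ℂ (Set.range fun i => B i) := by
      rw [← h]; exact Submodule.subset_span ⟨i, rfl⟩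
    exact (Submodule.mem_span_range_iff_exists_fun ℂ).1 this
  choose c hc using hmem
  have hAB : A = Matrix.of c * B := by
    ext i j
    rw [← hc i, Matrix.mul_apply]
    simp
  refine ⟨Matrix.of c, ?_, hAB⟩
  obtain ⟨G, hG⟩ := exists_mul_eq_one hA
  have : Matrix.of c * (B * G) = 1 := by rw [← Matrix.mul_assoc, ← hAB, hG]
  intro h0
  have h1 := congrArg Matrix.det this
  rw [Matrix.det_mul, h0, zero_mul, Matrix.det_one] at h1
  exact zero_ne_one h1

/-! ### Plücker coordinates -/

theorem IsPlucker.of_rows {N k : ℕ} {A : Matrix (Fin k) (Fin N) ℂ}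
    (hA : LinearIndependent ℂ (fun i => A i)) :
    IsPlucker (Submodule.span ℂ (Set.range fun i => A i)) fun I => (A.submatrix id I).det :=
  ⟨A, hA, rfl, 1, one_ne_zero, fun _ => (one_mul _).symm⟩

theorem exists_isPlucker {N k : ℕ} {U : Submodule ℂ (Fin N → ℂ)}
    (hU : Module.finrank ℂ U = k) : ∃ q : (Fin k ↪o Fin N) → ℂ, IsPlucker U q := by
  obtain ⟨A, hA, rfl⟩ := exists_rows hU
  exact ⟨_, IsPlucker.of_rows hA⟩

theorem exists_isMultiPlucker {s N : ℕ} {e : Fin s → ℕ} {x : Tuple s N} (hx : x ∈ multiGr N e) :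
    ∃ p, IsMultiPlucker e x p := by
  choose q hq using fun l => exists_isPlucker (hx l)
  exact ⟨fun c => q c.1 c.2, hq⟩

/-- Plücker coordinates are unique up to a scalar. -/
theorem IsPlucker.unique {N k : ℕ} {U : Submodule ℂ (Fin N → ℂ)} {q q' : (Fin k ↪o Fin N) → ℂ}
    (h : IsPlucker U q) (h' : IsPlucker U q') : ∃ c : ℂ, c ≠ 0 ∧ ∀ I, q I = c * q' I := by
  obtain ⟨A, hA, hAU, a, ha, hq⟩ := h
  obtain ⟨B, hB, hBU, b, hb, hq'⟩ := h'
  obtain ⟨H, hH, rfl⟩ := exists_eq_mul_of_span_eq hA (hAU.trans hBU.symm)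
  refine ⟨a * H.det / b, by positivity, fun I => ?_⟩
  have : (H * B).submatrix id I = H * B.submatrix id I := by
    ext i j; simp [Matrix.mul_apply]
  rw [hq, hq', this, Matrix.det_mul]
  field_simp

/-- In each monomial of `F` the exponents of the `l`-th block add up to `δ l`. This makes vanishing
at a tuple independent of the scaling of each factor's coordinates. -/
theorem IsMultihomogeneous.eval_smul {s N : ℕ} {e : Fin s → ℕ}
    {F : MvPolynomial (PluckerIndex N e) ℂ} {δ : Fin s → ℕ} (hF : IsMultihomogeneous F δ)
    (c : Fin s → ℂ) (p : PluckerIndex N e → ℂ) :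
    MvPolynomial.eval (fun i => c i.1 * p i) F = (∏ l, c l ^ δ l) * MvPolynomial.eval p F := by
  rw [MvPolynomial.eval_eq, MvPolynomial.eval_eq, Finset.mul_sum]
  refine Finset.sum_congr rfl fun m hm => ?_
  have hw := hF (MvPolynomial.mem_support_iff.1 hm)
  have hδ : ∀ l, δ l = ∑ I : Fin (e l) ↪o Fin N, m ⟨l, I⟩ := by
    intro l
    rw [← hw, Finsupp.weight_apply, Finsupp.sum_fintype _ _ (fun i => by simp),
      Finset.sum_apply, Fintype.sum_sigma, Finset.sum_eq_single l]
    · simp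
    · intro l' _ hne
      simp [hne.symm]
    · simp
  have hprod : ∀ r : PluckerIndex N e → ℂ, ∏ i ∈ m.support, r i ^ m i = ∏ i, r i ^ m i := by
    intro r
    refine Finset.prod_subset (Finset.subset_univ _) fun i _ hi => ?_
    rw [Finsupp.notMem_support_iff.1 hi, pow_zero]
  rw [hprod, hprod]
  simp only [mul_pow, Finset.prod_mul_distrib]
  have : ∏ i : PluckerIndex N e, c i.1 ^ m i = ∏ l, c l ^ δ l := by
    rw [Fintype.prod_sigma]
    refine Finset.prod_congr rfl fun l _ => ?_
    rw [hδ l]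
    exact Finset.prod_pow_eq_pow_sum Finset.univ (fun I => m ⟨l, I⟩) (c l)
  rw [this]
  ring

/-- A multihomogeneous polynomial vanishes at a point as soon as it vanishes at one choice of
Plücker coordinates. -/
theorem IsMultihomogeneous.vanishesAt {s N : ℕ} {e : Fin s → ℕ}
    {F : MvPolynomial (PluckerIndex N e) ℂ} {δ : Fin s → ℕ} (hF : IsMultihomogeneous F δ)
    {x : Tuple s N} {p : PluckerIndex N e → ℂ} (hp : IsMultiPlucker e x p)
    (h0 : MvPolynomial.eval p F = 0) : VanishesAt F x := by
  intro q hq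
  choose c hc hcq using fun l => (hq l).unique (hp l)
  have : q = fun i => c i.1 * p i := by
    ext ⟨l, I⟩; exact hcq l I
  rw [this, hF.eval_smul, h0, mul_zero]

theorem subset_zariskiClosure {s N : ℕ} {e : Fin s → ℕ} {A : Set (Tuple s N)}
    (hA : A ⊆ multiGr N e) : A ⊆ zariskiClosure e A :=
  fun x hx => ⟨hA hx, fun _ _ _ h => h x hx⟩

theorem zariskiClosure_mono {s N : ℕ} {e : Fin s → ℕ} {A B : Set (Tuple s N)} (h : A ⊆ B) :
    zariskiClosure e A ⊆ zariskiClosure e B :=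
  fun _ hx => ⟨hx.1, fun F δ hF hv => hx.2 F δ hF fun a ha => hv a (h ha)⟩

/-- The linear form in the Plücker coordinates of the `l`-th factor that is given by an alternating
form. -/
def linForm {s N : ℕ} (e : Fin s → ℕ) (l : Fin s) (ω : (Fin N → ℂ) [⋀^Fin (e l)]→ₗ[ℂ] ℂ) :
    MvPolynomial (PluckerIndex N e) ℂ :=
  ∑ J : Fin (e l) ↪o Fin N,
    MvPolynomial.C (ω fun i => Pi.single (J i) 1) * MvPolynomial.X ⟨l, J⟩

theorem linForm_isMultihomogeneous {s N : ℕ} (e : Fin s → ℕ) (l : Fin s)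
    (ω : (Fin N → ℂ) [⋀^Fin (e l)]→ₗ[ℂ] ℂ) :
    IsMultihomogeneous (linForm e l ω) (Pi.single l 1) :=
  MvPolynomial.IsWeightedHomogeneous.sum _ _ _ fun J _ =>
    MvPolynomial.IsWeightedHomogeneous.C_mul
      (MvPolynomial.isWeightedHomogeneous_X ℂ _ (⟨l, J⟩ : PluckerIndex N e)) _

theorem eval_linForm {s N : ℕ} {e : Fin s → ℕ} {l : Fin s}
    (ω : (Fin N → ℂ) [⋀^Fin (e l)]→ₗ[ℂ] ℂ) {p : PluckerIndex N e → ℂ} {c : ℂ}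
    {A : Matrix (Fin (e l)) (Fin N) ℂ} (hp : ∀ I, p ⟨l, I⟩ = c * (A.submatrix id I).det) :
    MvPolynomial.eval p (linForm e l ω) = c * ω fun i => A i := by
  rw [linForm, alternatingMap_eq_sum_minors ω A, map_sum, Finset.mul_sum]
  refine Finset.sum_congr rfl fun J _ => ?_
  rw [map_mul, MvPolynomial.eval_C, MvPolynomial.eval_X, hp]
  ring

/-! ### Closed conditions -/

/-- Orthogonality with respect to a fixed bilinear form is a closed condition. -/
theorem bilin_eq_zero_of_mem_zariskiClosure {s N : ℕ} {e : Fin s → ℕ} {X : Set (Tuple s N)}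
    (β : LinearMap.BilinForm ℂ (Fin N → ℂ)) (l l' : Fin s)
    (hX : ∀ x ∈ X, ∀ u ∈ x l, ∀ v ∈ x l', β u v = 0) {x : Tuple s N}
    (hx : x ∈ zariskiClosure e X) : ∀ u ∈ x l, ∀ v ∈ x l', β u v = 0 := by
  let ω : ∀ (l : Fin s) (_ : Matrix (Fin N) (Fin (e l)) ℂ) (_ : Fin (e l)) (_ : Fin N),
      (Fin N → ℂ) [⋀^Fin (e l)]→ₗ[ℂ] ℂ :=
    fun l G r i => detMulForm (G.updateCol r (Pi.single i 1))
  -- Cramer's rule: replacing column `r` of `G` by `e_i` yields coordinate `i` of a combination of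
  -- the rows of `A` with coefficients from row `r` of the adjugate of `A * G`. This vector is
  -- linear in the minors of `A`, lies in the row space for every `G`, and is row `r` itself when `A
  -- * G = 1`.
  have hω : ∀ (l : Fin s) (G : Matrix (Fin N) (Fin (e l)) ℂ) (r : Fin (e l))
      (A : Matrix (Fin (e l)) (Fin N) ℂ),
      (fun i => ω l G r i fun t => A t) = ∑ t, (A * G).adjugate r t • A t := by
    intro l G r A
    ext i
    have h1 : A * G.updateCol r (Pi.single i 1) = (A * G).updateCol r (fun t => A t i) := by
      ext a b
      by_cases hb : b = r
      · subst hb; simp [Matrix.mul_apply, Pi.single_apply]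
      · simp [Matrix.mul_apply, hb]
    simp only [ω, detMulForm_apply]
    rw [h1, ← Matrix.cramer_apply, Matrix.cramer_eq_adjugate_mulVec]
    simp [Matrix.mulVec, dotProduct]
  let F : ∀ (_ : Matrix (Fin N) (Fin (e l)) ℂ) (_ : Fin (e l)) (_ : Matrix (Fin N) (Fin (e l')) ℂ)
      (_ : Fin (e l')), MvPolynomial (PluckerIndex N e) ℂ := fun G r G' r' =>
    ∑ i, ∑ j, MvPolynomial.C (β (Pi.single i 1) (Pi.single j 1)) *
      (linForm e l (ω l G r i) * linForm e l' (ω l' G' r' j))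
  have hFhom : ∀ G r G' r', IsMultihomogeneous (F G r G' r') (Pi.single l 1 + Pi.single l' 1) := by
    intro G r G' r'
    refine MvPolynomial.IsWeightedHomogeneous.sum _ _ _ fun i _ =>
      MvPolynomial.IsWeightedHomogeneous.sum _ _ _ fun j _ =>
        MvPolynomial.IsWeightedHomogeneous.C_mul ?_ _
    exact (linForm_isMultihomogeneous e l _).mul (linForm_isMultihomogeneous e l' _)
  have hbil : ∀ u v : Fin N → ℂ, β u v =
      ∑ i, ∑ j, β (Pi.single i 1) (Pi.single j 1) * (u i * v j) := by
    intro u v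
    rw [LinearMap.BilinForm.apply_eq_dotProduct_toMatrix_mulVec (Pi.basisFun ℂ (Fin N))]
    simp only [dotProduct, Matrix.mulVec, Finset.mul_sum, LinearMap.BilinForm.toMatrix_apply,
      Pi.basisFun_apply, Pi.basisFun_repr]
    refine Finset.sum_congr rfl fun i _ => Finset.sum_congr rfl fun j _ => ?_
    ring
  have hFeval : ∀ G r G' r' (p : PluckerIndex N e → ℂ) (c c' : ℂ)
      (A : Matrix (Fin (e l)) (Fin N) ℂ) (A' : Matrix (Fin (e l')) (Fin N) ℂ),
      (∀ I, p ⟨l, I⟩ = c * (A.submatrix id I).det) →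
      (∀ I, p ⟨l', I⟩ = c' * (A'.submatrix id I).det) →
      MvPolynomial.eval p (F G r G' r') = c * c' *
        β (∑ t, (A * G).adjugate r t • A t) (∑ t, (A' * G').adjugate r' t • A' t) := by
    intro G r G' r' p c c' A A' hp hp'
    rw [← hω, ← hω, hbil, map_sum, Finset.mul_sum]
    refine Finset.sum_congr rfl fun i _ => ?_
    rw [map_sum, Finset.mul_sum]
    refine Finset.sum_congr rfl fun j _ => ?_
    rw [map_mul, map_mul, MvPolynomial.eval_C, eval_linForm _ hp, eval_linForm _ hp']
    ring
  obtain ⟨p, hp⟩ := exists_isMultiPlucker hx.1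
  obtain ⟨A, hA, hAU, c, hc, hq⟩ := hp l
  obtain ⟨A', hA', hAU', c', hc', hq'⟩ := hp l'
  obtain ⟨G, hG⟩ := exists_mul_eq_one hA
  obtain ⟨G', hG'⟩ := exists_mul_eq_one hA'
  have hrows : ∀ r r', β (A r) (A' r') = 0 := by
    intro r r'
    -- `G` and `G'` are adapted to `x` only, but the form vanishes on all of `X`: its value there is
    -- a multiple of `β` on a vector of `a l` and a vector of `a l'`.
    have hv : VanishesAt (F G r G' r') x := by
      refine hx.2 _ _ (hFhom G r G' r') fun a ha q hq => ?_
      obtain ⟨B, hB, hBU, d, hd, hqd⟩ := hq l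
      obtain ⟨B', hB', hBU', d', hd', hqd'⟩ := hq l'
      rw [hFeval G r G' r' q d d' B B' hqd hqd', hX a ha, mul_zero]
      · rw [← hBU]
        exact Submodule.sum_mem _ fun t _ => Submodule.smul_mem _ _ (Submodule.subset_span ⟨t, rfl⟩)
      · rw [← hBU']
        exact Submodule.sum_mem _ fun t _ => Submodule.smul_mem _ _ (Submodule.subset_span ⟨t, rfl⟩)
    have h0 := hv p hp
    rw [hFeval G r G' r' p c c' A A' hq hq', hG, hG'] at h0
    rw [Matrix.adjugate_one, Matrix.adjugate_one, Finset.sum_eq_single r,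
      Finset.sum_eq_single r'] at h0
    · simpa [hc, hc'] using h0
    · intro t _ ht; rw [Matrix.one_apply_ne ht.symm, zero_smul]
    · simp
    · intro t _ ht; rw [Matrix.one_apply_ne ht.symm, zero_smul]
    · simp
  intro u hu v hv
  rw [← hAU] at hu
  rw [← hAU'] at hv
  obtain ⟨a, rfl⟩ := (Submodule.mem_span_range_iff_exists_fun ℂ).1 hu
  obtain ⟨b, rfl⟩ := (Submodule.mem_span_range_iff_exists_fun ℂ).1 hv
  simp [hrows]

/-- The vanishing of a coordinate is a closed condition. -/
theorem apply_eq_zero_of_mem_zariskiClosure {s N : ℕ} {e : Fin s → ℕ} {X : Set (Tuple s N)}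
    (l : Fin s) (i : Fin N) (hX : ∀ x ∈ X, ∀ u ∈ x l, u i = 0) {x : Tuple s N}
    (hx : x ∈ zariskiClosure e X) : ∀ u ∈ x l, u i = 0 := by
  intro u hu
  -- The form `β u v = u i * v i` turns the coordinate into a square.
  have h := bilin_eq_zero_of_mem_zariskiClosure
    (LinearMap.BilinForm.linMulLin (LinearMap.proj i) (LinearMap.proj i)) l l
    (fun a ha v hv w _ => by simp [hX a ha v hv]) hx u hu u hu
  simpa using h

/-! ### Degenerations along curves -/

/-- If a multihomogeneous polynomial vanishes along a linear curve of tuples away from the parameter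
`0`, it vanishes at `0`. -/
theorem vanishesAt_of_curve {s N : ℕ} {e : Fin s → ℕ} {F : MvPolynomial (PluckerIndex N e) ℂ}
    {δ : Fin s → ℕ} (hF : IsMultihomogeneous F δ) {x : Tuple s N} (hx : x ∈ multiGr N e)
    (f g : (Fin N → ℂ) →ₗ[ℂ] (Fin N → ℂ)) (hinj : ∀ u : ℂ, Function.Injective (f + u • g))
    (hv : ∀ u : ℂ, u ≠ 0 → VanishesAt F fun l => (x l).map (f + u • g)) :
    VanishesAt F fun l => (x l).map f := by
  choose A hA hAx using fun l => exists_rows (hx l)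
  let P : PluckerIndex N e → Polynomial ℂ := fun c =>
    Matrix.det (Matrix.of fun i j => Polynomial.C (f (A c.1 i) (c.2 j)) +
      Polynomial.X * Polynomial.C (g (A c.1 i) (c.2 j)))
  have hP : ∀ u : ℂ, IsMultiPlucker e (fun l => (x l).map (f + u • g))
      (fun c => (P c).eval u) := by
    intro u l
    refine ⟨Matrix.of fun i => (f + u • g) (A l i), ?_, ?_, 1, one_ne_zero, fun I => ?_⟩
    · exact (hA l).map' _ (LinearMap.ker_eq_bot.2 (hinj u))
    · have : (Set.range fun i => Matrix.of (fun i => (f + u • g) (A l i)) i) =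
          (f + u • g) '' Set.range fun i => A l i := by rw [← Set.range_comp]; rfl
      rw [this, Submodule.span_image, hAx l]
    · rw [one_mul]
      change (Polynomial.evalRingHom u) (Matrix.det _) = _
      rw [RingHom.map_det]
      congr 1
      ext i j
      simp [-mul_eq_mul_left_iff, -mul_eq_mul_right_iff]
      ring
  let Q : Polynomial ℂ := MvPolynomial.eval₂ Polynomial.C P F
  have hQ : ∀ u, Q.eval u = MvPolynomial.eval (fun c => (P c).eval u) F := by
    intro u
    have h1 := MvPolynomial.hom_eval₂ F Polynomial.C (Polynomial.evalRingHom u) P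
    rw [Polynomial.coe_evalRingHom] at h1
    rw [h1, MvPolynomial.eval, MvPolynomial.coe_eval₂Hom]
    congr 1
    ext r
    simp
  -- A polynomial in the parameter `u` that vanishes for all `u ≠ 0` is zero, so it vanishes at `u =
  -- 0` too.
  have hQ0 : Q = 0 := by
    refine Polynomial.eq_zero_of_infinite_isRoot Q ?_
    refine Set.Infinite.mono (s := {u : ℂ | u ≠ 0}) ?_ ?_
    · intro u hu
      exact (hQ u).trans (hv u hu _ (hP u))
    · exact (Set.finite_singleton (0 : ℂ)).infinite_compl
  have h0 : MvPolynomial.eval (fun c => (P c).eval 0) F = 0 := by rw [← hQ, hQ0, Polynomial.eval_zero]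
  have := hP 0
  simp only [zero_smul, add_zero] at this
  exact hF.vanishesAt this h0

/-! ### Subspaces with a fixed part -/

/-- An alternating form in which the first vectors are fixed. -/
def fixLeft {ι κ M : Type*} [AddCommGroup M] [Module ℂ M] (ω : M [⋀^ι ⊕ κ]→ₗ[ℂ] ℂ) (c : ι → M) :
    M [⋀^κ]→ₗ[ℂ] ℂ where
  toFun v := ω (Sum.elim c v)
  map_update_add' v i x y := by
    classical
    have h : ∀ z, Sum.elim c (Function.update v i z) =
        Function.update (Sum.elim c v) (Sum.inr i) z := fun z => by
      funext t
      rcases t with t | t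
      · simp
      · by_cases ht : t = i
        · subst ht; simp
        · simp [ht]
    rw [h, h, h, ω.map_update_add]
  map_update_smul' v i a x := by
    classical
    have h : ∀ z, Sum.elim c (Function.update v i z) =
        Function.update (Sum.elim c v) (Sum.inr i) z := fun z => by
      funext t
      rcases t with t | t
      · simp
      · by_cases ht : t = i
        · subst ht; simp
        · simp [ht]
    rw [h, h, ω.map_update_smul]
  map_eq_zero_of_eq' v i j hij hne :=
    ω.map_eq_zero_of_eq (Sum.elim c v) (i := Sum.inr i) (j := Sum.inr j) hij
      (fun h => hne (Sum.inr_injective h))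

/-- Vectors `C` in a space `ℂ ^ N'`, and an embedding of `ℂ ^ N` into a complement of their span:
`ρ` and `ψ` are the corresponding coordinates. -/
structure Splitting (p N N' : ℕ) where
  C : Fin p → (Fin N' → ℂ)
  φ : (Fin N → ℂ) →ₗ[ℂ] (Fin N' → ℂ)
  ρ : (Fin N' → ℂ) →ₗ[ℂ] (Fin p → ℂ)
  ψ : (Fin N' → ℂ) →ₗ[ℂ] (Fin N → ℂ)
  ρ_C : ∀ i, ρ (C i) = Pi.single i 1
  ψ_C : ∀ i, ψ (C i) = 0
  ρ_φ : ∀ v, ρ (φ v) = 0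
  ψ_φ : ∀ v, ψ (φ v) = v

namespace Splitting

variable {p N N' : ℕ} (S : Splitting p N N')

/-- The sum of the fixed subspace and the image of `U`. -/
def extend (U : Submodule ℂ (Fin N → ℂ)) : Submodule ℂ (Fin N' → ℂ) :=
  Submodule.span ℂ (Set.range S.C) ⊔ U.map S.φ

theorem φ_injective : Function.Injective S.φ :=
  Function.LeftInverse.injective S.ψ_φ

theorem ψ_of_mem_span {w : Fin N' → ℂ} (hw : w ∈ Submodule.span ℂ (Set.range S.C)) :
    S.ψ w = 0 := by
  have : Submodule.span ℂ (Set.range S.C) ≤ LinearMap.ker S.ψ := by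
    rw [Submodule.span_le]
    rintro _ ⟨i, rfl⟩
    exact S.ψ_C i
  exact this hw

theorem linearIndependent_C : LinearIndependent ℂ S.C := by
  apply LinearIndependent.of_comp S.ρ
  have : S.ρ ∘ S.C = Pi.basisFun ℂ (Fin p) := by
    ext i : 1
    simp [S.ρ_C]
  rw [this]
  exact (Pi.basisFun ℂ (Fin p)).linearIndependent

theorem map_ψ_extend (U : Submodule ℂ (Fin N → ℂ)) : (S.extend U).map S.ψ = U := by
  rw [extend, Submodule.map_sup, ← Submodule.map_comp]
  have h1 : (Submodule.span ℂ (Set.range S.C)).map S.ψ = ⊥ := by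
    rw [eq_bot_iff]
    rintro _ ⟨w, hw, rfl⟩
    exact (Submodule.mem_bot ℂ).2 (S.ψ_of_mem_span hw)
  have h2 : S.ψ ∘ₗ S.φ = LinearMap.id := LinearMap.ext S.ψ_φ
  rw [h1, h2, Submodule.map_id, bot_sup_eq]

theorem extend_injective : Function.Injective S.extend :=
  Function.LeftInverse.injective S.map_ψ_extend

theorem φ_mem_extend_iff {U : Submodule ℂ (Fin N → ℂ)} {v : Fin N → ℂ} :
    S.φ v ∈ S.extend U ↔ v ∈ U := by
  constructor
  · intro h
    rw [← S.map_ψ_extend U]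
    exact ⟨_, h, S.ψ_φ v⟩
  · exact fun h => Submodule.mem_sup_right ⟨v, h, rfl⟩

/-- The rows that span `S.extend U`, if those of `A` span `U`. -/
def rows {k k' : ℕ} (ε : Fin p ⊕ Fin k ≃ Fin k') (A : Matrix (Fin k) (Fin N) ℂ) :
    Matrix (Fin k') (Fin N') ℂ :=
  Matrix.of fun i => Sum.elim S.C (fun j => S.φ (A j)) (ε.symm i)

theorem rows_apply {k k' : ℕ} (ε : Fin p ⊕ Fin k ≃ Fin k') (A : Matrix (Fin k) (Fin N) ℂ)
    (a : Fin p ⊕ Fin k) : S.rows ε A (ε a) = Sum.elim S.C (fun j => S.φ (A j)) a := by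
  change Sum.elim _ _ (ε.symm (ε a)) = _
  rw [Equiv.symm_apply_apply]

theorem linearIndependent_rows {k k' : ℕ} (ε : Fin p ⊕ Fin k ≃ Fin k')
    {A : Matrix (Fin k) (Fin N) ℂ} (hA : LinearIndependent ℂ fun i => A i) :
    LinearIndependent ℂ fun i => S.rows ε A i := by
  have h : LinearIndependent ℂ (Sum.elim S.C fun j => S.φ (A j)) := by
    refine LinearIndependent.sum_type S.linearIndependent_C
      (hA.map' S.φ (LinearMap.ker_eq_bot.2 S.φ_injective)) ?_
    rw [Submodule.disjoint_def]
    intro w hw hw'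
    have : w ∈ LinearMap.range S.φ := by
      refine Submodule.span_le.2 ?_ hw'
      rintro _ ⟨j, rfl⟩
      exact ⟨_, rfl⟩
    obtain ⟨z, rfl⟩ := this
    have := S.ψ_of_mem_span hw
    rw [S.ψ_φ] at this
    rw [this, map_zero]
  exact h.comp _ ε.symm.injective

theorem span_rows {k k' : ℕ} (ε : Fin p ⊕ Fin k ≃ Fin k') (A : Matrix (Fin k) (Fin N) ℂ) :
    Submodule.span ℂ (Set.range fun i => S.rows ε A i) =
      S.extend (Submodule.span ℂ (Set.range fun i => A i)) := by
  have : (Set.range fun i => S.rows ε A i) =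
      Set.range S.C ∪ S.φ '' (Set.range fun i => A i) := by
    rw [← Set.range_comp]
    change Set.range ((Sum.elim S.C fun j => S.φ (A j)) ∘ ε.symm) = _
    rw [ε.symm.surjective.range_comp, Set.Sum.elim_range]
    rfl
  rw [this, Submodule.span_union, Submodule.span_image]
  rfl

theorem finrank_extend (U : Submodule ℂ (Fin N → ℂ)) :
    Module.finrank ℂ (S.extend U) = p + Module.finrank ℂ U := by
  obtain ⟨A, hA, hU⟩ := exists_rows (U := U) rfl
  have h := finrank_span_eq_card (S.linearIndependent_rows finSumFinEquiv hA)
  rw [S.span_rows, hU, Fintype.card_fin] at h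
  exact h

/-- The Plücker coordinates of `S.extend U` are linear in those of `U`. -/
theorem exists_forms_extend {s : ℕ} (e : Fin s → ℕ) (l : Fin s) {k' : ℕ}
    (hk : p + e l = k') : ∃ F : (Fin k' ↪o Fin N') → MvPolynomial (PluckerIndex N e) ℂ,
      (∀ I, IsMultihomogeneous (F I) (Pi.single l 1)) ∧
      ∀ (x : Tuple s N) (q : PluckerIndex N e → ℂ), IsMultiPlucker e x q →
        IsPlucker (S.extend (x l)) fun I => MvPolynomial.eval q (F I) := by
  let ε : Fin p ⊕ Fin (e l) ≃ Fin k' := finSumFinEquiv.trans (finCongr hk)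
  -- A maximal minor of the stacked rows `C` and `φ A`; for fixed `C` it is alternating in the rows
  -- of `A`.
  let ω : (Fin k' ↪o Fin N') → (Fin N → ℂ) [⋀^Fin (e l)]→ₗ[ℂ] ℂ := fun I =>
    (fixLeft (Matrix.detRowAlternating.compLinearMap (LinearMap.funLeft ℂ ℂ (I ∘ ε)))
      S.C).compLinearMap S.φ
  have hω : ∀ I (A : Matrix (Fin (e l)) (Fin N) ℂ),
      ω I (fun i => A i) = ((S.rows ε A).submatrix id I).det := by
    intro I A
    rw [← Matrix.det_submatrix_equiv_self ε]
    change Matrix.det _ = _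
    congr 1
    ext a b
    simp [rows, LinearMap.funLeft]
  refine ⟨fun I => linForm e l (ω I), fun I => linForm_isMultihomogeneous _ _ _,
    fun x q hq => ?_⟩
  obtain ⟨A, hA, hAU, c, hc, hqc⟩ := hq l
  refine ⟨S.rows ε A, S.linearIndependent_rows ε hA, ?_, c, hc, fun I => ?_⟩
  · rw [S.span_rows, hAU]
  · change MvPolynomial.eval q (linForm e l (ω I)) = _
    rw [eval_linForm _ hqc, hω]

/-- The Plücker coordinates of `U` are linear in those of `S.extend U`. -/
theorem exists_forms_of_extend {s : ℕ} (e : Fin s → ℕ) (l : Fin s) {k : ℕ}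
    (hk : p + k = e l) : ∃ F : (Fin k ↪o Fin N) → MvPolynomial (PluckerIndex N' e) ℂ,
      (∀ I, IsMultihomogeneous (F I) (Pi.single l 1)) ∧
      ∀ (y : Tuple s N') (q : PluckerIndex N' e → ℂ), IsMultiPlucker e y q →
        ∀ U : Submodule ℂ (Fin N → ℂ), Module.finrank ℂ U = k → S.extend U = y l →
          IsPlucker U fun I => MvPolynomial.eval q (F I) := by
  let ε : Fin p ⊕ Fin k ≃ Fin (e l) := finSumFinEquiv.trans (finCongr hk)
  -- The coordinates `ρ` together with those of `ψ` in the columns `J`. On the rows that span the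
  -- extension they give a block diagonal matrix with blocks `1` and the submatrix `J` of `A`, so
  -- the determinant extracts that minor. Another basis only contributes the factor `det H`.
  let γ : (Fin k ↪o Fin N) → (Fin N' → ℂ) →ₗ[ℂ] (Fin (e l) → ℂ) := fun J =>
    LinearMap.pi fun i => Sum.elim (fun a => LinearMap.proj a ∘ₗ S.ρ)
      (fun b => LinearMap.proj (J b) ∘ₗ S.ψ) (ε.symm i)
  let ω : (Fin k ↪o Fin N) → (Fin N' → ℂ) [⋀^Fin (e l)]→ₗ[ℂ] ℂ := fun J =>
    Matrix.detRowAlternating.compLinearMap (γ J)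
  have hω : ∀ J (H : Matrix (Fin (e l)) (Fin (e l)) ℂ) (A : Matrix (Fin k) (Fin N) ℂ),
      ω J (fun i => (H * S.rows ε A) i) = H.det * (A.submatrix id J).det := by
    intro J H A
    have h1 : ω J (fun i => (H * S.rows ε A) i) =
        Matrix.det (H * Matrix.of fun i => γ J (S.rows ε A i)) := by
      change Matrix.det _ = _
      congr 1
      ext i j
      have : (H * S.rows ε A) i = ∑ t, H i t • S.rows ε A t := by
        ext b; simp [Matrix.mul_apply]
      simp only [this, map_sum, map_smul]
      simp [Matrix.mul_apply]
    rw [h1, Matrix.det_mul]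
    congr 1
    rw [← Matrix.det_submatrix_equiv_self ε]
    have h2 : (Matrix.of fun i => γ J (S.rows ε A i)).submatrix ε ε =
        Matrix.fromBlocks 1 0 0 (A.submatrix id J) := by
      ext a b
      rcases a with a | a <;> rcases b with b | b <;>
        simp [γ, S.rows_apply, S.ρ_C, S.ψ_C, S.ρ_φ, S.ψ_φ, Matrix.one_apply, Pi.single_apply, eq_comm]
    rw [h2, Matrix.det_fromBlocks_zero₁₂, Matrix.det_one, one_mul]
  refine ⟨fun I => linForm e l (ω I), fun I => linForm_isMultihomogeneous _ _ _,
    fun y q hq U hU hUy => ?_⟩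
  obtain ⟨A, hA, hAU⟩ := exists_rows hU
  obtain ⟨B, hB, hBU, c, hc, hqc⟩ := hq l
  obtain ⟨H, hH, rfl⟩ := exists_eq_mul_of_span_eq (B := S.rows ε A) hB
    (by rw [hBU, S.span_rows, hAU, hUy])
  refine ⟨A, hA, hAU, c * H.det, mul_ne_zero hc hH, fun I => ?_⟩
  change MvPolynomial.eval q (linForm e l (ω I)) = _
  rw [eval_linForm _ hqc, hω]
  ring

end Splitting

theorem IsPlucker.exists_ne_zero {N k : ℕ} {U : Submodule ℂ (Fin N → ℂ)}
    {q : (Fin k ↪o Fin N) → ℂ} (h : IsPlucker U q) : ∃ I, q I ≠ 0 := by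
  obtain ⟨A, hA, -, c, hc, hq⟩ := h
  obtain ⟨I, hI⟩ := exists_minor_ne_zero hA
  exact ⟨I, by rw [hq]; exact mul_ne_zero hc hI⟩

/-- A map whose Plücker coordinates are given by forms that nowhere vanish simultaneously is
regular. -/
theorem isRegularMap_of_forms {s s' N N' : ℕ} {e : Fin s → ℕ} {e' : Fin s' → ℕ}
    {X : Set (Tuple s N)} (hX : X ⊆ multiGr N e) {φ : X → Tuple s' N'}
    (h : ∀ l, ∃ (δ : Fin s → ℕ) (F : (Fin (e' l) ↪o Fin N') → MvPolynomial (PluckerIndex N e) ℂ),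
      (∀ I, IsMultihomogeneous (F I) δ) ∧ ∀ (y : X) (p : PluckerIndex N e → ℂ),
        IsMultiPlucker e y.1 p → IsPlucker (φ y l) fun I => MvPolynomial.eval p (F I)) :
    IsRegularMap e e' X φ := by
  intro x l
  obtain ⟨δ, F, hF, hφ⟩ := h l
  refine ⟨δ, F, hF, ?_, fun y p hp _ => hφ y p hp⟩
  obtain ⟨p, hp⟩ := exists_isMultiPlucker (hX x.2)
  obtain ⟨I, hI⟩ := (hφ x p hp).exists_ne_zero
  exact ⟨I, fun hv => hI (hv p hp)⟩

/-! ### Coordinate subspaces -/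

/-- The span of the basis vectors with index in `S`. -/
def coordSub {N : ℕ} (S : Set (Fin N)) : Submodule ℂ (Fin N → ℂ) where
  carrier := {v | ∀ i, i ∉ S → v i = 0}
  add_mem' hv hw i hi := by simp [hv i hi, hw i hi]
  zero_mem' _ _ := rfl
  smul_mem' c v hv i hi := by simp [hv i hi]

theorem mem_coordSub {N : ℕ} {S : Set (Fin N)} {v : Fin N → ℂ} :
    v ∈ coordSub S ↔ ∀ i, i ∉ S → v i = 0 := Iff.rfl

theorem single_mem_coordSub {N : ℕ} {S : Set (Fin N)} {i : Fin N} :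
    Pi.single i (1 : ℂ) ∈ coordSub S ↔ i ∈ S := by
  constructor
  · intro h
    by_contra hi
    simpa using h i hi
  · intro hi j hj
    refine Pi.single_eq_of_ne (fun h => hj ?_) _
    rw [h]
    exact hi

theorem coordSub_mono {N : ℕ} {S S' : Set (Fin N)} : coordSub S ≤ coordSub S' ↔ S ⊆ S' := by
  constructor
  · intro h i hi
    exact single_mem_coordSub.1 (h (single_mem_coordSub.2 hi))
  · exact fun h v hv i hi => hv i fun hi' => hi (h hi')

theorem coordSub_le_iff {N : ℕ} {S : Set (Fin N)} {U : Submodule ℂ (Fin N → ℂ)} :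
    coordSub S ≤ U ↔ ∀ i ∈ S, Pi.single i 1 ∈ U := by
  constructor
  · exact fun h i hi => h (single_mem_coordSub.2 hi)
  · intro h v hv
    rw [← Finset.univ_sum_single v]
    refine Submodule.sum_mem _ fun i _ => ?_
    by_cases hi : i ∈ S
    · have : (Pi.single i (v i) : Fin N → ℂ) = v i • Pi.single i (1 : ℂ) := by
        rw [← Pi.single_smul, smul_eq_mul, mul_one]
      rw [this]
      exact Submodule.smul_mem _ _ (h i hi)
    · rw [hv i hi, Pi.single_zero]
      exact Submodule.zero_mem _

theorem coordSub_eq_span {N : ℕ} (S : Set (Fin N)) :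
    coordSub S = Submodule.span ℂ ((fun i => Pi.single i (1 : ℂ)) '' S) := by
  apply le_antisymm
  · exact coordSub_le_iff.2 fun i hi => Submodule.subset_span ⟨i, hi, rfl⟩
  · rw [Submodule.span_le]
    rintro _ ⟨i, hi, rfl⟩
    exact single_mem_coordSub.2 hi

theorem finrank_coordSub {N : ℕ} (S : Finset (Fin N)) :
    Module.finrank ℂ (coordSub (S : Set (Fin N))) = S.card := by
  have hli : LinearIndependent ℂ fun i : S => (Pi.single (i : Fin N) 1 : Fin N → ℂ) := by
    have h := (Pi.basisFun ℂ (Fin N)).linearIndependent.comp (fun i : S => (i : Fin N))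
      Subtype.val_injective
    convert h using 1
    ext i : 1
    simp
  have hr : (Set.range fun i : S => (Pi.single (i : Fin N) 1 : Fin N → ℂ)) =
      (fun i => Pi.single i (1 : ℂ)) '' (S : Set (Fin N)) := by
    ext v; simp
  rw [coordSub_eq_span, ← hr, finrank_span_eq_card hli, Fintype.card_coe]

/-! ### The symplectic form on `W` -/

/-- The sign of `formW n` on `e_i` and its dual vector. -/
def formSign (n : ℕ) (i : Fin (2 * n)) : ℂ := if (i : ℕ) < n then 1 else -1

theorem formSign_rev {n : ℕ} (i : Fin (2 * n)) : formSign n (Fin.rev i) = -formSign n i := by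
  have := i.2
  simp only [formSign, Fin.val_rev]
  by_cases h : (i : ℕ) < n
  · rw [if_pos h, if_neg (by omega)]
  · rw [if_neg h, if_pos (by omega), neg_neg]

theorem formSign_mul_self {n : ℕ} (i : Fin (2 * n)) : formSign n i * formSign n i = 1 := by
  unfold formSign
  split_ifs <;> norm_num

theorem formSign_ne_zero {n : ℕ} (i : Fin (2 * n)) : formSign n i ≠ 0 := by
  unfold formSign
  split_ifs <;> norm_num

theorem rev_ne_self {n : ℕ} (i : Fin (2 * n)) : Fin.rev i ≠ i := by
  intro h
  have h1 := congrArg Fin.val h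
  have := i.2
  rw [Fin.val_rev] at h1
  omega

theorem formMatrix_apply {n : ℕ} (i j : Fin (2 * n)) :
    formMatrix n i j = if j = Fin.rev i then formSign n i else 0 := by
  have := i.2
  have := j.2
  have h : (i : ℕ) + j + 1 = 2 * n ↔ j = Fin.rev i := by
    rw [Fin.ext_iff, Fin.val_rev]; omega
  simp only [formMatrix, Matrix.of_apply, h, formSign]

theorem formW_apply {n : ℕ} (v w : Fin (2 * n) → ℂ) :
    formW n v w = ∑ i, formSign n i * v i * w (Fin.rev i) := by
  rw [formW, Matrix.toBilin'_apply]
  refine Finset.sum_congr rfl fun i _ => ?_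
  simp only [formMatrix_apply, mul_ite, ite_mul, mul_zero, zero_mul, Finset.sum_ite_eq',
    Finset.mem_univ, if_true]
  ring

theorem formW_single_right {n : ℕ} (v : Fin (2 * n) → ℂ) (i : Fin (2 * n)) :
    formW n v (Pi.single i 1) = -formSign n i * v (Fin.rev i) := by
  rw [formW_apply, Finset.sum_eq_single (Fin.rev i)]
  · simp [formSign_rev]
  · intro j _ hj
    rw [Pi.single_eq_of_ne, mul_zero]
    intro h
    exact hj (by rw [← h, Fin.rev_rev])
  · simp

theorem formW_neg {n : ℕ} (v w : Fin (2 * n) → ℂ) : formW n v w = -formW n w v := by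
  rw [formW_apply, formW_apply, ← Equiv.sum_comp Fin.revPerm, ← Finset.sum_neg_distrib]
  refine Finset.sum_congr rfl fun i _ => ?_
  simp only [Fin.revPerm_apply, formSign_rev, Fin.rev_rev]
  ring

theorem formW_single_left {n : ℕ} (v : Fin (2 * n) → ℂ) (i : Fin (2 * n)) :
    formW n (Pi.single i 1) v = formSign n i * v (Fin.rev i) := by
  rw [formW_neg, formW_single_right]
  ring

theorem formW_isAlt (n : ℕ) : (formW n).IsAlt := fun v => by
  have := formW_neg v v
  exact self_eq_neg.1 this

theorem formW_isRefl (n : ℕ) : (formW n).IsRefl := (formW_isAlt n).isRefl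

theorem formW_nondegenerate (n : ℕ) : (formW n).Nondegenerate := by
  have h : ∀ v : Fin (2 * n) → ℂ, (∀ w, formW n v w = 0) → v = 0 := by
    intro v hv
    ext i
    have := hv (Pi.single (Fin.rev i) 1)
    rw [formW_single_right, Fin.rev_rev] at this
    simpa [formSign_ne_zero] using this
  exact ⟨h, fun v hv => h v fun w => by rw [formW_neg, hv, neg_zero]⟩

/-- A basis vector pairs nontrivially only with the one at the reversed index. -/
theorem orthogonal_coordSub {n : ℕ} (S : Set (Fin (2 * n))) :
    (formW n).orthogonal (coordSub S) = coordSub {i | Fin.rev i ∉ S} := by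
  ext v
  rw [LinearMap.BilinForm.mem_orthogonal_iff, mem_coordSub]
  constructor
  · intro h i hi
    have := h _ (single_mem_coordSub.2 (not_not.1 hi))
    rw [formW_single_left, Fin.rev_rev] at this
    simpa [formSign_ne_zero] using this
  · intro h w hw
    rw [formW_apply]
    refine Finset.sum_eq_zero fun i _ => ?_
    by_cases hi : i ∈ S
    · rw [h (Fin.rev i) (by simpa using hi), mul_zero]
    · rw [hw i hi, mul_zero, zero_mul]

theorem iota_eq_self_iff {n s : ℕ} {x : Tuple s (2 * n)} :
    iota (formW n) x = x ↔ ∀ l, (formW n).orthogonal (x (Fin.rev l)) = x l :=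
  funext_iff

/-- A containment between fixed points of the involution is an equality. -/
theorem eq_of_le_of_iota_eq_self {n s : ℕ} {x y : Tuple s (2 * n)} (hx : iota (formW n) x = x)
    (hy : iota (formW n) y = y) (h : ∀ l, x l ≤ y l) : x = y := by
  ext1 l
  refine le_antisymm (h l) ?_
  rw [← iota_eq_self_iff.1 hx l, ← iota_eq_self_iff.1 hy l]
  exact LinearMap.BilinForm.orthogonal_le (h _)

/-! ### The symplectic group -/

theorem det_eq_one_of_formW {n : ℕ} {g : Matrix (Fin (2 * n)) (Fin (2 * n)) ℂ}
    (hg : ∀ v w, formW n (g.mulVec v) (g.mulVec w) = formW n v w) : g.det = 1 := by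
  have hM : g.transpose * formMatrix n * g = formMatrix n := by
    apply Matrix.toBilin'.injective
    ext v w
    simp only [LinearMap.coe_comp, Function.comp_apply,
      LinearMap.coe_single]
    have h := hg (Pi.single v 1) (Pi.single w 1)
    unfold formW at h
    rw [← h, Matrix.toBilin'_apply', Matrix.toBilin'_apply', ← Matrix.mulVec_mulVec,
      ← Matrix.mulVec_mulVec, Matrix.dotProduct_mulVec, Matrix.vecMul_transpose]
  -- Reversing the second half of the basis turns the form into `-J`, so that `g` becomes an element
  -- of `Matrix.symplecticGroup`, where the determinant is known to be `1`.
  let ε : Fin n ⊕ Fin n ≃ Fin (2 * n) :=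
    ((Equiv.refl _).sumCongr Fin.revPerm).trans (finSumFinEquiv.trans (finCongr (two_mul n).symm))
  have hJ : (formMatrix n).submatrix ε ε = -Matrix.J (Fin n) ℂ := by
    have hl : ∀ i, (ε (Sum.inl i) : ℕ) = i := fun i => by simp [ε]
    have hr : ∀ i, (ε (Sum.inr i) : ℕ) = n + (n - (i + 1)) := fun i => by
      simp [ε, Nat.add_comm]
    ext a b
    rcases a with a | a <;> rcases b with b | b <;> have := a.2 <;> have := b.2 <;>
      simp only [Matrix.submatrix_apply, formMatrix, Matrix.of_apply, hl, hr, Matrix.J,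
        Matrix.neg_apply, Matrix.fromBlocks_apply₁₁, Matrix.fromBlocks_apply₁₂,
        Matrix.fromBlocks_apply₂₁, Matrix.fromBlocks_apply₂₂, Matrix.one_apply, Matrix.zero_apply,
        Fin.ext_iff]
    · rw [if_neg (by omega), neg_zero]
    · by_cases h : (a : ℕ) = b
      · rw [if_pos (by omega), if_pos (by omega), if_pos h, neg_neg]
      · rw [if_neg (by omega), if_neg h, neg_zero, neg_zero]
    · by_cases h : (a : ℕ) = b
      · rw [if_pos (by omega), if_neg (by omega), if_pos h]
      · rw [if_neg (by omega), if_neg h, neg_zero]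
    · rw [if_neg (by omega), neg_zero]
  have hmem : g.submatrix ε ε ∈ Matrix.symplecticGroup (Fin n) ℂ := by
    rw [SymplecticGroup.mem_iff']
    have h := congrArg (fun A => A.submatrix ε ε) hM
    simp only [← Matrix.submatrix_mul_equiv _ _ ε ε ε, hJ, ← Matrix.transpose_submatrix] at h
    simpa using h
  rw [← Matrix.det_submatrix_equiv_self ε, SymplecticGroup.det_eq_one hmem]

/-- The element of `SL_{2n}` given by a linear map that preserves the symplectic form. -/
def ofIsometry {n : ℕ} (f : (Fin (2 * n) → ℂ) →ₗ[ℂ] (Fin (2 * n) → ℂ))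
    (hf : ∀ v w, formW n (f v) (f w) = formW n v w) : SL n :=
  ⟨LinearMap.toMatrix' f, det_eq_one_of_formW (by simpa using hf)⟩

theorem toLin'_ofIsometry {n : ℕ} {f : (Fin (2 * n) → ℂ) →ₗ[ℂ] (Fin (2 * n) → ℂ)}
    (hf : ∀ v w, formW n (f v) (f w) = formW n v w) :
    Matrix.toLin' (ofIsometry f hf).1 = f := Matrix.toLin'_toMatrix' f

theorem act_ofIsometry {n s : ℕ} {f : (Fin (2 * n) → ℂ) →ₗ[ℂ] (Fin (2 * n) → ℂ)}
    (hf : ∀ v w, formW n (f v) (f w) = formW n v w) (x : Tuple s (2 * n)) :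
    act (ofIsometry f hf) x = fun l => (x l).map f := by
  unfold act
  rw [toLin'_ofIsometry]

theorem mem_symplectic_iff {n : ℕ} {g : SL n} : g ∈ symplectic n ↔
    ∀ v w, formW n (Matrix.toLin' g.1 v) (Matrix.toLin' g.1 w) = formW n v w := Iff.rfl

theorem ofIsometry_mem {n : ℕ} {f : (Fin (2 * n) → ℂ) →ₗ[ℂ] (Fin (2 * n) → ℂ)}
    (hf : ∀ v w, formW n (f v) (f w) = formW n v w) : ofIsometry f hf ∈ symplectic n := by
  rw [mem_symplectic_iff, toLin'_ofIsometry]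
  exact hf

theorem toLin'_mul_SL {n : ℕ} (g h : SL n) :
    Matrix.toLin' (g * h).1 = Matrix.toLin' g.1 ∘ₗ Matrix.toLin' h.1 := Matrix.toLin'_mul _ _

theorem act_mul {n s : ℕ} (g h : SL n) (x : Tuple s (2 * n)) : act (g * h) x = act g (act h x) := by
  ext1 l
  simp only [act, toLin'_mul_SL, Submodule.map_comp]

theorem act_one {n s : ℕ} (x : Tuple s (2 * n)) : act (1 : SL n) x = x := by
  ext1 l
  simp [act]

theorem symplectic_one_mem (n : ℕ) : (1 : SL n) ∈ symplectic n := by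
  intro v w; simp

theorem symplectic_mul_mem {n : ℕ} {g h : SL n} (hg : g ∈ symplectic n) (hh : h ∈ symplectic n) :
    g * h ∈ symplectic n := by
  rw [mem_symplectic_iff] at *
  intro v w
  rw [toLin'_mul_SL, LinearMap.comp_apply, LinearMap.comp_apply, hg, hh]

theorem symplectic_inv_mem {n : ℕ} {g : SL n} (hg : g ∈ symplectic n) : g⁻¹ ∈ symplectic n := by
  rw [mem_symplectic_iff] at *
  intro v w
  have h : ∀ v, Matrix.toLin' g.1 (Matrix.toLin' g⁻¹.1 v) = v := fun v => by
    rw [← LinearMap.comp_apply, ← toLin'_mul_SL, mul_inv_cancel]; simp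
  rw [← hg, h, h]

theorem toLin'_SL_injective {n : ℕ} (g : SL n) : Function.Injective (Matrix.toLin' g.1) := by
  have h : ∀ v, Matrix.toLin' g⁻¹.1 (Matrix.toLin' g.1 v) = v := fun v => by
    rw [← LinearMap.comp_apply, ← toLin'_mul_SL, inv_mul_cancel]; simp
  exact Function.LeftInverse.injective h

theorem act_mem_multiGr {n s : ℕ} {e : Fin s → ℕ} {x : Tuple s (2 * n)} (g : SL n)
    (hx : x ∈ multiGr (2 * n) e) : act g x ∈ multiGr (2 * n) e := fun l => by
  rw [← hx l]
  exact (Submodule.equivMapOfInjective _ (toLin'_SL_injective g) _).finrank_eq.symm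

theorem iota_act {n s : ℕ} {g : SL n} (hg : g ∈ symplectic n) (x : Tuple s (2 * n)) :
    iota (formW n) (act g x) = act g (iota (formW n) x) := by
  rw [mem_symplectic_iff] at hg
  have h : ∀ v, Matrix.toLin' g.1 (Matrix.toLin' g⁻¹.1 v) = v := fun v => by
    rw [← LinearMap.comp_apply, ← toLin'_mul_SL, mul_inv_cancel]; simp
  ext l v
  simp only [iota, act, LinearMap.BilinForm.mem_orthogonal_iff,  Submodule.mem_map]
  constructor
  · intro hv
    refine ⟨Matrix.toLin' g⁻¹.1 v, fun u hu => ?_, h v⟩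
    rw [← hg, h]
    exact hv _ ⟨u, hu, rfl⟩
  · rintro ⟨w, hw, rfl⟩ _ ⟨u, hu, rfl⟩
    rw [hg]
    exact hw u hu

theorem borel_mul_mem {n : ℕ} {g h : SL n} (hg : g ∈ borel n) (hh : h ∈ borel n) :
    g * h ∈ borel n := by
  intro i j hij
  rw [Matrix.SpecialLinearGroup.coe_mul, Matrix.mul_apply]
  refine Finset.sum_eq_zero fun k _ => ?_
  rcases lt_or_ge k i with hk | hk
  · rw [hg i k hk, zero_mul]
  · rw [hh k j (lt_of_lt_of_le hij hk), mul_zero]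

/-- Upper triangular matrices preserve the members of the standard flag. -/
theorem apply_eq_zero_of_borel {n : ℕ} {g : SL n} (hg : g ∈ borel n) {j : ℕ}
    {v : Fin (2 * n) → ℂ} (hv : ∀ i : Fin (2 * n), j ≤ i → v i = 0) (i : Fin (2 * n))
    (hi : j ≤ i) : Matrix.toLin' g.1 v i = 0 := by
  rw [Matrix.toLin'_apply, Matrix.mulVec, dotProduct]
  refine Finset.sum_eq_zero fun k _ => ?_
  rcases lt_or_ge k i with hk | hk
  · rw [hg i k hk, zero_mul]
  · rw [hv k (hi.trans hk), mul_zero]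

/-! ### Coordinate flags -/

/-- The coordinate flag in which `e_i` enters at step `τ i`. -/
def levelFlag {n : ℕ} (s : ℕ) (τ : Fin (2 * n) → ℕ) : Tuple s (2 * n) :=
  fun l => coordSub {i | τ i ≤ l}

theorem mem_levelFlag {n s : ℕ} {τ : Fin (2 * n) → ℕ} {l : Fin s} {v : Fin (2 * n) → ℂ} :
    v ∈ levelFlag s τ l ↔ ∀ i, (l : ℕ) < τ i → v i = 0 := by
  simp [levelFlag, mem_coordSub]

/-- `e_i` is orthogonal to the member `rev l` exactly when `e_{rev i}` has not entered by step `s -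
1 - l`; by the symmetry of `τ` this says `τ i ≤ l`. The level `s` means that the vector never
enters. -/
theorem iota_levelFlag {n s : ℕ} {τ : Fin (2 * n) → ℕ} (hτ : ∀ i, τ i + τ (Fin.rev i) = s) :
    iota (formW n) (levelFlag s τ) = levelFlag s τ := by
  rw [iota_eq_self_iff]
  intro l
  rw [levelFlag, orthogonal_coordSub]
  congr 1
  ext i
  have := hτ i
  have := l.2
  simp only [Set.mem_ofPred_eq, Fin.val_rev]
  omega

/-! ### Root subgroups -/

/-- The Siegel transformation `v ↦ v + u (⟨v, x⟩ y + ⟨v, y⟩ x)`. -/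
def siegelMap {n : ℕ} (x y : Fin (2 * n) → ℂ) (u : ℂ) :
    (Fin (2 * n) → ℂ) →ₗ[ℂ] (Fin (2 * n) → ℂ) :=
  LinearMap.id + u • (((formW n).flip x).smulRight y + ((formW n).flip y).smulRight x)

theorem siegelMap_apply {n : ℕ} (x y : Fin (2 * n) → ℂ) (u : ℂ) (v : Fin (2 * n) → ℂ) :
    siegelMap x y u v = v + u • (formW n v x • y + formW n v y • x) := rfl

/-- The terms quadratic in `u` vanish since `x` and `y` span an isotropic subspace; the linear ones
cancel by skew symmetry. -/
theorem formW_siegelMap {n : ℕ} {x y : Fin (2 * n) → ℂ} (hxy : formW n x y = 0) (u : ℂ)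
    (v w : Fin (2 * n) → ℂ) : formW n (siegelMap x y u v) (siegelMap x y u w) = formW n v w := by
  have hyx : formW n y x = 0 := by rw [formW_neg, hxy, neg_zero]
  have hxx : formW n x x = 0 := formW_isAlt n x
  have hyy : formW n y y = 0 := formW_isAlt n y
  simp only [siegelMap_apply, map_add, map_smul, LinearMap.add_apply, LinearMap.smul_apply,
    smul_eq_mul, hxy, hyx, hxx, hyy]
  rw [formW_neg x w, formW_neg y w]
  ring

theorem siegelMap_siegelMap {n : ℕ} {x y : Fin (2 * n) → ℂ} (hxy : formW n x y = 0) (u u' : ℂ)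
    (v : Fin (2 * n) → ℂ) : siegelMap x y u (siegelMap x y u' v) = siegelMap x y (u + u') v := by
  have hyx : formW n y x = 0 := by rw [formW_neg, hxy, neg_zero]
  have hxx : formW n x x = 0 := formW_isAlt n x
  have hyy : formW n y y = 0 := formW_isAlt n y
  simp only [siegelMap_apply, map_add, map_smul, LinearMap.add_apply, LinearMap.smul_apply, hxy,
    hyx, hxx, hyy]
  module

/-- The root subgroup that adds multiples of `e_b` to `e_a`. -/
def rootMap {n : ℕ} (a b : Fin (2 * n)) (u : ℂ) : (Fin (2 * n) → ℂ) →ₗ[ℂ] (Fin (2 * n) → ℂ) :=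
  siegelMap (Pi.single (Fin.rev a) 1) (Pi.single b 1) u

theorem formW_single_rev_single {n : ℕ} {a b : Fin (2 * n)} (hab : a ≠ b) :
    formW n (Pi.single (Fin.rev a) 1) (Pi.single b 1) = 0 := by
  rw [formW_single_left, Fin.rev_rev, Pi.single_eq_of_ne hab, mul_zero]

theorem formW_rootMap {n : ℕ} {a b : Fin (2 * n)} (hab : a ≠ b) (u : ℂ) (v w : Fin (2 * n) → ℂ) :
    formW n (rootMap a b u v) (rootMap a b u w) = formW n v w :=
  formW_siegelMap (formW_single_rev_single hab) u v w

/-- For `b = Fin.rev a`, a long root, both corrections fall on the same coordinate and add up to a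
factor `2`. -/
theorem rootMap_apply {n : ℕ} (a b : Fin (2 * n)) (u : ℂ) (v : Fin (2 * n) → ℂ) (i : Fin (2 * n)) :
    rootMap a b u v i = v i + u * ((if i = b then formSign n a * v a else 0) -
      if i = Fin.rev a then formSign n b * v (Fin.rev b) else 0) := by
  simp only [rootMap, siegelMap_apply, formW_single_right, Fin.rev_rev, formSign_rev, Pi.add_apply,
    Pi.smul_apply, smul_eq_mul, Pi.single_apply]
  split_ifs <;> ring

theorem rootMap_injective {n : ℕ} {a b : Fin (2 * n)} (hab : a ≠ b) (u : ℂ) :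
    Function.Injective (rootMap a b u) := by
  have h : ∀ v, rootMap a b (-u) (rootMap a b u v) = v := fun v => by
    unfold rootMap
    rw [siegelMap_siegelMap (formW_single_rev_single hab), neg_add_cancel, siegelMap_apply,
      zero_smul, add_zero]
  exact Function.LeftInverse.injective h

/-- The reflection that exchanges `a` and `b`, and their dual indices. -/
def reflection {n : ℕ} (a b : Fin (2 * n)) : Equiv.Perm (Fin (2 * n)) :=
  if b = Fin.rev a then Equiv.swap a b
  else Equiv.swap (Fin.rev a) (Fin.rev b) * Equiv.swap a b

theorem reflection_apply {n : ℕ} {a b : Fin (2 * n)} (hab : a ≠ b) (i : Fin (2 * n)) :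
    reflection a b i = if i = a then b else if i = b then a else if i = Fin.rev a then Fin.rev b
      else if i = Fin.rev b then Fin.rev a else i := by
  have ha := rev_ne_self a
  have hb := rev_ne_self b
  have hab' : Fin.rev a ≠ Fin.rev b := fun h => hab (Fin.rev_injective h)
  have hrr : ∀ i : Fin (2 * n), Fin.rev (Fin.rev i) = i := Fin.rev_rev
  unfold reflection
  by_cases h : b = Fin.rev a
  · subst h
    rw [if_pos rfl, Equiv.swap_apply_def]
    grind
  · have h' : a ≠ Fin.rev b := fun h' => h (by rw [h', Fin.rev_rev])
    rw [if_neg h, Equiv.Perm.mul_apply, Equiv.swap_apply_def, Equiv.swap_apply_def]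
    grind

theorem reflection_rev {n : ℕ} {a b : Fin (2 * n)} (hab : a ≠ b) (i : Fin (2 * n)) :
    reflection a b (Fin.rev i) = Fin.rev (reflection a b i) := by
  have ha := rev_ne_self a
  have hb := rev_ne_self b
  have hrr : ∀ i : Fin (2 * n), Fin.rev (Fin.rev i) = i := Fin.rev_rev
  rw [reflection_apply hab, reflection_apply hab]
  grind

theorem comp_reflection_symm {n s : ℕ} {τ : Fin (2 * n) → ℕ} (hτ : ∀ i, τ i + τ (Fin.rev i) = s)
    {a b : Fin (2 * n)} (hab : a ≠ b) (i : Fin (2 * n)) :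
    (τ ∘ reflection a b) i + (τ ∘ reflection a b) (Fin.rev i) = s := by
  simp only [Function.comp_apply, reflection_rev hab, hτ]

/-- The rearrangement inequality: only the terms at `a` and `b` change. -/
theorem sum_mul_swap_lt {ι : Type*} [Fintype ι] [DecidableEq ι] {w τ : ι → ℕ} {a b : ι}
    (hw : w a < w b) (hτ : τ a < τ b) :
    ∑ i, w i * τ (Equiv.swap a b i) < ∑ i, w i * τ i := by
  have hab : a ≠ b := fun h => by rw [h] at hw; exact lt_irrefl _ hw
  have hb : b ∈ (Finset.univ : Finset ι).erase a := by simp [hab.symm]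
  rw [← Finset.add_sum_erase _ _ (Finset.mem_univ a), ← Finset.add_sum_erase _ _ hb,
    ← Finset.add_sum_erase _ (fun i => w i * τ i) (Finset.mem_univ a),
    ← Finset.add_sum_erase _ (fun i => w i * τ i) hb, ← add_assoc, ← add_assoc]
  have hrest : ∑ i ∈ (Finset.univ.erase a).erase b, w i * τ (Equiv.swap a b i) =
      ∑ i ∈ (Finset.univ.erase a).erase b, w i * τ i := by
    refine Finset.sum_congr rfl fun i hi => ?_
    simp only [Finset.mem_erase] at hi
    rw [Equiv.swap_apply_of_ne_of_ne hi.2.1 hi.1]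
  rw [hrest, Equiv.swap_apply_left, Equiv.swap_apply_right]
  have := mul_add_mul_lt_mul_add_mul hw hτ
  omega

/-- The measure for the inductions on coordinate flags. A reflection is one swap or two disjoint
swaps, each of which lowers the sum. -/
theorem sum_mul_reflection_lt {n : ℕ} {w τ : Fin (2 * n) → ℕ} {a b : Fin (2 * n)}
    (hw : w a < w b) (hw' : w (Fin.rev b) < w (Fin.rev a)) (hτ : τ a < τ b)
    (hτ' : τ (Fin.rev b) < τ (Fin.rev a)) :
    ∑ i, w i * (τ ∘ reflection a b) i < ∑ i, w i * τ i := by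
  have hab : a ≠ b := fun h => by rw [h] at hw; exact lt_irrefl _ hw
  unfold reflection
  split_ifs with h
  · exact sum_mul_swap_lt hw hτ
  · have h' : a ≠ Fin.rev b := fun h' => h (by rw [h', Fin.rev_rev])
    rw [Equiv.swap_comm (Fin.rev a)]
    have h1 := sum_mul_swap_lt hw' hτ'
    refine lt_trans ?_ h1
    refine sum_mul_swap_lt (τ := fun i => τ (Equiv.swap (Fin.rev b) (Fin.rev a) i)) hw ?_
    rw [Equiv.swap_apply_of_ne_of_ne h' (rev_ne_self a).symm,
      Equiv.swap_apply_of_ne_of_ne (rev_ne_self b).symm h]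
    exact hτ

/-- A root subgroup moves a coordinate flag into the opposite root group orbit of its reflection. -/
theorem exists_map_rootMap_levelFlag {n s : ℕ} {τ : Fin (2 * n) → ℕ}
    (hτ : ∀ i, τ i + τ (Fin.rev i) = s) {a b : Fin (2 * n)} (hab : τ a < τ b) {u : ℂ}
    (hu : u ≠ 0) : ∃ c : ℂ, (fun l => (levelFlag s τ l).map (rootMap a b u)) =
      fun l => (levelFlag s (τ ∘ reflection a b) l).map (rootMap b a c) := by
  have hne : a ≠ b := fun h => by rw [h] at hab; exact lt_irrefl _ hab
  have hsa := formSign_mul_self a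
  have hsb := formSign_mul_self b
  have hτa := hτ a
  have hτb := hτ b
  have hrr : ∀ i : Fin (2 * n), Fin.rev (Fin.rev i) = i := Fin.rev_rev
  have ha := rev_ne_self a
  have hb := rev_ne_self b
  have hkey : ∃ c : ℂ, ∀ (l : Fin s) (v : Fin (2 * n) → ℂ), v ∈ levelFlag s τ l →
      rootMap b a (-c) (rootMap a b u v) ∈ levelFlag s (τ ∘ reflection a b) l := by
    by_cases h : b = Fin.rev a
    · subst h
      -- Both root maps carry a factor `2` here. When `v` has no coordinate at `Fin.rev a`, the
      -- coordinate at `a` becomes `v a * (1 + 4 * c * u)`, which determines `c`.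
      refine ⟨-(1 / (4 * u)), fun l v hv => ?_⟩
      rw [mem_levelFlag] at hv ⊢
      intro i hi
      have hvi := hv i
      have hva := hv a
      have hvb := hv (Fin.rev a)
      rw [Function.comp_apply, reflection_apply hne] at hi
      simp only [rootMap_apply, hrr, formSign_rev, if_true]
      by_cases h1 : i = a
      · subst h1
        rw [if_pos rfl] at hi
        simp only [hvb hi, hne, if_true, if_false]
        field_simp
        linear_combination (-4) * u * v i * hsa
      · by_cases h2 : i = Fin.rev a
        · subst h2
          rw [if_neg h1, if_pos rfl] at hi
          simp [hva hi, hvb (hi.trans hab), h1]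
        · simp only [h1, h2, hrr, if_false] at hi ⊢
          rw [hvi hi]
          ring
    · have h' : a ≠ Fin.rev b := fun h' => h (by rw [h', Fin.rev_rev])
      have hab' : Fin.rev a ≠ Fin.rev b := fun h => hne (Fin.rev_injective h)
      have hsab : formSign n a * formSign n b ≠ 0 :=
        mul_ne_zero (formSign_ne_zero a) (formSign_ne_zero b)
      -- When `v b = 0`, the coordinate at `a` becomes `v a * (1 - c * u * formSign n a * formSign n
      -- b)`, and the signs square to `1`. In rank one: the line of `e_a + u e_b` is also that of
      -- `e_b + u⁻¹ e_a`.
      refine ⟨formSign n a * formSign n b / u, fun l v hv => ?_⟩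
      rw [mem_levelFlag] at hv ⊢
      intro i hi
      rw [Function.comp_apply, reflection_apply hne] at hi
      simp only [rootMap_apply, h, Ne.symm h, if_false, if_true]
      by_cases h1 : i = a
      · subst h1
        rw [if_pos rfl] at hi
        have hvb := hv b hi
        simp only [hvb, h', hne, ha.symm, if_true, if_false]
        field_simp
        linear_combination (-u * v i) * formSign n b ^ 2 * hsa - u * v i * hsb
      · by_cases h2 : i = b
        · subst h2
          rw [if_neg h1, if_pos rfl] at hi
          simp [h, h1, hb.symm, hv a hi, hv i (hi.trans hab)]
        · by_cases h3 : i = Fin.rev a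
          · subst h3
            rw [if_neg h1, if_neg h2, if_pos rfl] at hi
            simp [h1, h2, hab', hv _ hi, hv (Fin.rev a) (by omega)]
          · by_cases h4 : i = Fin.rev b
            · subst h4
              rw [if_neg h1, if_neg h2, if_neg h3, if_pos rfl] at hi
              simp only [h1, h2, h3, hv _ hi, if_true, if_false]
              field_simp
              linear_combination (-u * v (Fin.rev b)) * formSign n b ^ 2 * hsa -
                u * v (Fin.rev b) * hsb
            · simp only [h1, h2, h3, h4, if_false] at hi ⊢
              rw [hv i hi]
              ring
  obtain ⟨c, hc⟩ := hkey
  refine ⟨c, ?_⟩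
  have hι : ∀ (f : (Fin (2 * n) → ℂ) →ₗ[ℂ] (Fin (2 * n) → ℂ))
      (_ : ∀ v w, formW n (f v) (f w) = formW n v w) (σ : Fin (2 * n) → ℕ)
      (_ : ∀ i, σ i + σ (Fin.rev i) = s), iota (formW n) (fun l => (levelFlag s σ l).map f) =
        fun l => (levelFlag s σ l).map f := by
    intro f hf σ hσ
    rw [← act_ofIsometry hf, iota_act (ofIsometry_mem hf), iota_levelFlag hσ]
  -- Both tuples are fixed by the involution, so the inclusion proved in `hkey` is enough.
  refine eq_of_le_of_iota_eq_self (hι _ (formW_rootMap hne u) τ hτ)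
    (hι _ (formW_rootMap hne.symm c) _ (comp_reflection_symm hτ hne)) ?_
  rintro l _ ⟨v, hv, rfl⟩
  refine ⟨_, hc l v hv, ?_⟩
  unfold rootMap
  rw [siegelMap_siegelMap (formW_single_rev_single hne.symm), add_neg_cancel, siegelMap_apply,
    zero_smul, add_zero]

/-! ### Bruhat decomposition -/

/-- Dualize the inclusion `(A^⊥ + B^⊥)^⊥ ≤ A ⊓ B`, using that double orthogonals are trivial. -/
theorem orthogonal_inf_le {n : ℕ} (A B : Submodule ℂ (Fin (2 * n) → ℂ)) :
    (formW n).orthogonal (A ⊓ B) ≤ (formW n).orthogonal A ⊔ (formW n).orthogonal B := by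
  have hoo := LinearMap.BilinForm.orthogonal_orthogonal (formW_nondegenerate n) (formW_isRefl n)
  have h : (formW n).orthogonal ((formW n).orthogonal A ⊔ (formW n).orthogonal B) ≤ A ⊓ B := by
    refine le_inf ?_ ?_
    · conv_rhs => rw [← hoo A]
      exact LinearMap.BilinForm.orthogonal_le le_sup_left
    · conv_rhs => rw [← hoo B]
      exact LinearMap.BilinForm.orthogonal_le le_sup_right
  have h' := LinearMap.BilinForm.orthogonal_le (B := formW n) h
  rwa [hoo] at h'

/-- The pairing of two vectors with dual leading positions. -/
theorem formW_of_leading {n : ℕ} {i : Fin (2 * n)} {v w : Fin (2 * n) → ℂ}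
    (hv : ∀ j, i < j → v j = 0) (hw : ∀ j, Fin.rev i < j → w j = 0) :
    formW n v w = formSign n i * v i * w (Fin.rev i) := by
  rw [formW_apply]
  refine Finset.sum_eq_single i (fun j _ hj => ?_) (by simp)
  rcases lt_or_gt_of_ne hj with h | h
  · rw [hw _ (Fin.rev_lt_rev.2 h), mul_zero]
  · rw [hv j h, mul_zero, zero_mul]

theorem formW_of_leading_lt {n : ℕ} {i k : Fin (2 * n)} {v w : Fin (2 * n) → ℂ}
    (hv : ∀ j, i < j → v j = 0) (hw : ∀ j, k < j → w j = 0) (hik : i < Fin.rev k) :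
    formW n v w = 0 := by
  have hk : k < Fin.rev i := by rw [← Fin.rev_lt_rev, Fin.rev_rev]; exact hik
  rw [formW_of_leading hv fun j hj => hw j (hk.trans hj), hw _ hk, mul_zero]

/-- Some vector of `U` has leading position `i`. -/
def HasLeading {n : ℕ} (U : Submodule ℂ (Fin (2 * n) → ℂ)) (i : Fin (2 * n)) : Prop :=
  ∃ v ∈ U, v i = 1 ∧ ∀ j, i < j → v j = 0

/-- Vectors with dual leading positions pair to a nonzero number, so not both sides can have one.
Conversely, if `i` is not leading in `U`, then `U ∩ F_{≤ i} ⊆ F_{< i}`; dually `F_{< i}^⊥ ⊆ U^⊥ +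
F_{≤ i}^⊥`, and decomposing `e_{rev i}` accordingly produces the vector of `U^⊥`. -/
theorem hasLeading_orthogonal_iff {n : ℕ} (U : Submodule ℂ (Fin (2 * n) → ℂ)) (i : Fin (2 * n)) :
    HasLeading ((formW n).orthogonal U) (Fin.rev i) ↔ ¬ HasLeading U i := by
  constructor
  · rintro ⟨w, hw, hwi, hwj⟩ ⟨v, hv, hvi, hvj⟩
    have h : formW n v w = 0 := hw v hv
    rw [formW_of_leading hvj hwj, hvi, hwi] at h
    simp [formSign_ne_zero] at h
  · intro h
    have hle : U ⊓ coordSub {j | j ≤ i} ≤ coordSub {j | j < i} := by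
      rintro v ⟨hvU, hv⟩ j hj
      rw [Set.mem_ofPred_eq, not_lt] at hj
      rcases hj.lt_or_eq with hj | rfl
      · exact hv j (by simpa using hj)
      · by_contra hne
        refine h ⟨(v i)⁻¹ • v, U.smul_mem _ hvU, by simp [hne], fun j hj => ?_⟩
        have : v j = 0 := hv j (by simpa using hj)
        simp [this]
    have hmem := (LinearMap.BilinForm.orthogonal_le (B := formW n) hle).trans
      (orthogonal_inf_le _ _)
    rw [orthogonal_coordSub, orthogonal_coordSub] at hmem
    have he : Pi.single (Fin.rev i) (1 : ℂ) ∈ coordSub {j | Fin.rev j ∉ {j : Fin (2 * n) | j < i}} :=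
      single_mem_coordSub.2 (by simp)
    obtain ⟨w, hw, z, hz, hwz⟩ := Submodule.mem_sup.1 (hmem he)
    have hz' : ∀ j, Fin.rev i ≤ j → z j = 0 := fun j hj => hz j (by
      have : Fin.rev j ≤ i := by rw [← Fin.rev_le_rev, Fin.rev_rev]; exact hj
      simpa using this)
    have hw' : ∀ j, Fin.rev i ≤ j → w j = (Pi.single (Fin.rev i) (1 : ℂ) : Fin (2 * n) → ℂ) j :=
      fun j hj => by rw [← hwz, Pi.add_apply, hz' j hj, add_zero]
    refine ⟨w, hw, ?_, fun j hj => ?_⟩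
    · rw [hw' _ le_rfl, Pi.single_eq_same]
    · rw [hw' _ hj.le, Pi.single_eq_of_ne hj.ne']

/-- `τ i` is the first step at which `i` is a leading position, or `s` if there is none. The duality
of leading positions in `U` and `U^⊥` makes `τ` symmetric. -/
theorem exists_level {n s : ℕ} {y : Tuple s (2 * n)} (hmono : Monotone y)
    (hι : iota (formW n) y = y) : ∃ τ : Fin (2 * n) → ℕ, (∀ i, τ i + τ (Fin.rev i) = s) ∧
      ∀ i (l : Fin s), τ i ≤ l ↔ HasLeading (y l) i := by
  classical
  have hex : ∀ i : Fin (2 * n), ∃ k, k = s ∨ ∃ h : k < s, HasLeading (y ⟨k, h⟩) i :=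
    fun i => ⟨s, Or.inl rfl⟩
  let τ : Fin (2 * n) → ℕ := fun i => Nat.find (hex i)
  have hle : ∀ i, τ i ≤ s := fun i => Nat.find_min' (hex i) (Or.inl rfl)
  have hτ : ∀ i (l : Fin s), τ i ≤ l ↔ HasLeading (y l) i := by
    intro i l
    constructor
    · intro h
      rcases Nat.find_spec (hex i) with h' | ⟨h', v, hv, hvi⟩
      · exact absurd (h'.symm.le.trans h) (not_le.2 l.2)
      · exact ⟨v, hmono (show (⟨τ i, h'⟩ : Fin s) ≤ l from h) hv, hvi⟩
    · exact fun h => Nat.find_min' (hex i) (Or.inr ⟨l.2, h⟩)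
  refine ⟨τ, fun i => ?_, hτ⟩
  have hdual : ∀ l : Fin s, τ (Fin.rev i) ≤ (Fin.rev l : Fin s) ↔ ¬ τ i ≤ l := by
    intro l
    have h := iota_eq_self_iff.1 hι (Fin.rev l)
    rw [Fin.rev_rev] at h
    rw [hτ, hτ, ← h, hasLeading_orthogonal_iff]
  simp only [Fin.val_rev] at hdual
  have h1 := hle i
  have h2 := hle (Fin.rev i)
  rcases Nat.eq_zero_or_pos (τ i) with h0 | h0
  · rcases Nat.eq_zero_or_pos s with hs | hs
    · omega
    · have := hdual ⟨0, hs⟩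
      simp only at this
      omega
  · have h3 := hdual ⟨τ i - 1, by omega⟩
    simp only at h3
    rcases h1.lt_or_eq with h | h
    · have h4 := hdual ⟨τ i, h⟩
      simp only at h4
      omega
    · omega

/-- A partial symplectic basis that is adapted to the standard flag and to `y`. -/
theorem exists_adapted_family {n s : ℕ} {y : Tuple s (2 * n)} (hmono : Monotone y)
    (hι : iota (formW n) y = y) {τ : Fin (2 * n) → ℕ} (hτs : ∀ i, τ i + τ (Fin.rev i) = s)
    (hτ : ∀ i (l : Fin s), τ i ≤ l ↔ HasLeading (y l) i) (k : ℕ) :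
    ∃ g : Fin (2 * n) → (Fin (2 * n) → ℂ), (∀ i, g i i = 1) ∧ (∀ i j, i < j → g i j = 0) ∧
      (∀ i (l : Fin s), τ i ≤ l → g i ∈ y l) ∧
      ∀ i j : Fin (2 * n), (i : ℕ) < k → (j : ℕ) < k → formW n (g i) (g j) = formMatrix n i j := by
  induction k with
  | zero =>
    have h : ∀ i, ∃ v : Fin (2 * n) → ℂ, v i = 1 ∧ (∀ j, i < j → v j = 0) ∧
        ∀ l : Fin s, τ i ≤ l → v ∈ y l := by
      intro i
      by_cases hi : τ i < s
      · obtain ⟨v, hv, hvi, hvj⟩ := (hτ i ⟨τ i, hi⟩).1 le_rfl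
        exact ⟨v, hvi, hvj, fun l hl => hmono (show (⟨τ i, hi⟩ : Fin s) ≤ l from hl) hv⟩
      -- A position that leads in no member has no membership to satisfy, so `e_i` itself serves.
      · exact ⟨Pi.single i 1, Pi.single_eq_same _ _, fun j hj => Pi.single_eq_of_ne hj.ne' _,
          fun l hl => absurd (hl.trans_lt l.2) hi⟩
    choose g h1 h2 h3 using h
    exact ⟨g, h1, h2, h3, fun i j hi => absurd hi (Nat.not_lt_zero _)⟩
  | succ k ih =>
    obtain ⟨g, h1, h2, h3, h4⟩ := ih
    by_cases hk : 2 * n ≤ k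
    · exact ⟨g, h1, h2, h3, fun i j _ _ => h4 i j (i.2.trans_le hk) (j.2.trans_le hk)⟩
    push Not at hk
    let κ : Fin (2 * n) := ⟨k, hk⟩
    -- Gram–Schmidt: only the pairings of `g κ` with `g i` for `rev κ < i < κ` need correcting. For
    -- `i < rev κ` they vanish by leading positions, and for `i = rev κ` the normalization already
    -- gives the right sign. The correcting vectors `g (rev i)` have leading position below `κ`.
    let t : Finset (Fin (2 * n)) := Finset.univ.filter fun i => Fin.rev κ < i ∧ i < κ
    let w : Fin (2 * n) → ℂ :=
      g κ - ∑ i ∈ t, (formSign n i * formW n (g i) (g κ)) • g (Fin.rev i)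
    have ht : ∀ i ∈ t, Fin.rev κ < i ∧ i < κ ∧ Fin.rev i < κ := fun i hi => by
      have := (Finset.mem_filter.1 hi).2
      refine ⟨this.1, this.2, ?_⟩
      rw [← Fin.rev_lt_rev, Fin.rev_rev]
      exact this.1
    have hwlead : ∀ j, κ ≤ j → w j = g κ j := by
      intro j hj
      simp only [w, Pi.sub_apply, Finset.sum_apply, Pi.smul_apply]
      rw [Finset.sum_eq_zero, sub_zero]
      intro i hi
      rw [h2 _ _ ((ht i hi).2.2.trans_le hj), smul_zero]
    have hwj : ∀ j, κ < j → w j = 0 := fun j hj => by rw [hwlead j hj.le, h2 _ _ hj]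
    have hwκ : w κ = 1 := by rw [hwlead κ le_rfl, h1]
    have hform : ∀ i, i < κ → formW n (g i) w = formMatrix n i κ := by
      intro i hi
      rw [formMatrix_apply]
      rcases lt_trichotomy i (Fin.rev κ) with h | h | h
      · rw [formW_of_leading_lt (h2 i) hwj h, if_neg]
        intro hκ
        rw [hκ, Fin.rev_rev] at h
        exact lt_irrefl _ h
      · have hκ : κ = Fin.rev i := by rw [h, Fin.rev_rev]
        have hwj' : ∀ j, Fin.rev i < j → w j = 0 := fun j hj => hwj j (by rw [hκ]; exact hj)
        rw [if_pos hκ, formW_of_leading (h2 i) hwj', ← hκ, h1, hwκ, mul_one, mul_one]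
      · have hκ : κ ≠ Fin.rev i := fun hκ => by
          rw [hκ, Fin.rev_rev] at h
          exact lt_irrefl _ h
        have hit : i ∈ t := Finset.mem_filter.2 ⟨Finset.mem_univ _, h, hi⟩
        rw [if_neg hκ]
        simp only [w, map_sub, map_sum, map_smul]
        rw [Finset.sum_eq_single i]
        · rw [h4 i (Fin.rev i) hi (ht i hit).2.2, formMatrix_apply, if_pos rfl, smul_eq_mul]
          linear_combination (-formW n (g i) (g κ)) * formSign_mul_self i
        · intro j hj hji
          rw [h4 i (Fin.rev j) hi (ht j hj).2.2, formMatrix_apply, if_neg, smul_zero]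
          exact fun h => hji (Fin.rev_injective h)
        · exact fun h => absurd hit h
    have hne : ∀ i : Fin (2 * n), (i : ℕ) < k → i ≠ κ := fun i hi h => by
      rw [h] at hi
      exact lt_irrefl _ hi
    refine ⟨Function.update g κ w, fun i => ?_, fun i j hij => ?_, fun i l hl => ?_,
      fun i j hi hj => ?_⟩
    · by_cases hi : i = κ
      · rw [hi, Function.update_self, hwκ]
      · rw [Function.update_of_ne hi, h1]
    · by_cases hi : i = κ
      · rw [hi, Function.update_self, hwj j (hi ▸ hij)]
      · rw [Function.update_of_ne hi, h2 _ _ hij]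
    · by_cases hi : i = κ
      · rw [hi] at hl ⊢
        rw [Function.update_self]
        refine Submodule.sub_mem _ (h3 κ l hl) (Submodule.sum_mem _ fun j hj => ?_)
        -- The correction does not leave `y l`: if `g (rev j)` is not yet available there, then `g
        -- j` lies in `y (rev l)`, the orthogonal of `y l`, and the coefficient is zero.
        by_cases hjl : τ (Fin.rev j) ≤ l
        · exact Submodule.smul_mem _ _ (h3 _ _ hjl)
        · have hj' : τ j ≤ (Fin.rev l : Fin s) := by
            have := hτs j
            have := l.2
            rw [Fin.val_rev]
            omega
          have horth : formW n (g j) (g κ) = 0 := by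
            have hm := h3 κ l hl
            rw [← iota_eq_self_iff.1 hι l] at hm
            exact hm _ (h3 j _ hj')
          rw [horth, mul_zero, zero_smul]
          exact Submodule.zero_mem _
      · rw [Function.update_of_ne hi]
        exact h3 i l hl
    · rcases Nat.lt_succ_iff_lt_or_eq.1 hi with hi' | hi' <;>
        rcases Nat.lt_succ_iff_lt_or_eq.1 hj with hj' | hj'
      · rw [Function.update_of_ne (hne i hi'), Function.update_of_ne (hne j hj'), h4 i j hi' hj']
      · obtain rfl : j = κ := Fin.ext hj'
        rw [Function.update_of_ne (hne i hi'), Function.update_self, hform i hi']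
      · have hiκ : i = κ := Fin.ext hi'
        rw [hiκ, Function.update_of_ne (hne j hj'), Function.update_self, formW_neg, hform j hj',
          formMatrix_apply, formMatrix_apply]
        by_cases h : κ = Fin.rev j
        · have h' : j = Fin.rev κ := by rw [h, Fin.rev_rev]
          rw [if_pos h, if_pos h', h, formSign_rev]
        · have h' : j ≠ Fin.rev κ := fun h' => h (by rw [h', Fin.rev_rev])
          rw [if_neg h, if_neg h', neg_zero]
      · have hiκ : i = κ := Fin.ext hi'
        have hjκ : j = κ := Fin.ext hj'
        rw [hiκ, hjκ, Function.update_self, formMatrix_apply, if_neg (rev_ne_self κ).symm]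
        exact formW_isAlt n w

/-- Every flag that is fixed by the involution is the translate of a coordinate flag under the Borel
subgroup of the symplectic group. -/
theorem exists_eq_act_levelFlag {n s : ℕ} {y : Tuple s (2 * n)} (hmono : Monotone y)
    (hι : iota (formW n) y = y) : ∃ τ : Fin (2 * n) → ℕ, (∀ i, τ i + τ (Fin.rev i) = s) ∧
      (∀ i (l : Fin s), τ i ≤ l ↔ HasLeading (y l) i) ∧
      ∃ g ∈ borel n ∩ symplectic n, y = act g (levelFlag s τ) := by
  obtain ⟨τ, hτs, hτ⟩ := exists_level hmono hι
  obtain ⟨g, h1, h2, h3, h4⟩ := exists_adapted_family hmono hι hτs hτ (2 * n)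
  let f : (Fin (2 * n) → ℂ) →ₗ[ℂ] (Fin (2 * n) → ℂ) := Fintype.linearCombination ℂ g
  have hfs : ∀ i, f (Pi.single i 1) = g i := fun i => by
    simp [f, Fintype.linearCombination_apply_single]
  have hf : ∀ v w, formW n (f v) (f w) = formW n v w := by
    intro v w
    have hvw : formW n v w = ∑ i, ∑ j, v i * formMatrix n i j * w j := Matrix.toBilin'_apply _ _ _
    rw [hvw]
    simp only [f, Fintype.linearCombination_apply, map_sum, map_smul, LinearMap.sum_apply,
      LinearMap.smul_apply, smul_eq_mul, Finset.mul_sum]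
    rw [Finset.sum_comm]
    refine Finset.sum_congr rfl fun i _ => Finset.sum_congr rfl fun j _ => ?_
    rw [h4 i j i.2 j.2]
    ring
  refine ⟨τ, hτs, hτ, ofIsometry f hf, ⟨fun i j hij => ?_, ofIsometry_mem hf⟩, ?_⟩
  · rw [← h2 j i hij, ← hfs]
    change LinearMap.toMatrix' f i j = _
    rw [LinearMap.toMatrix'_apply]
  · symm
    refine eq_of_le_of_iota_eq_self ?_ hι fun l => ?_
    · rw [iota_act (ofIsometry_mem hf), iota_levelFlag hτs]
    · rw [act_ofIsometry, Submodule.map_le_iff_le_comap]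
      refine coordSub_le_iff.2 fun i hi => ?_
      rw [Submodule.mem_comap, hfs]
      exact h3 i l hi

/-! ### Coordinate flags in the flag variety of the symplectic group -/

theorem coordFlag_eq {n s : ℕ} (d : Fin s → ℕ) (τ : ℕ → ℕ) (l : Fin s) :
    coordFlag n d τ l = coordSub {k | ∃ r, 1 ≤ r ∧ r ≤ flagDim d l ∧ τ r = (k : ℕ) + 1} := by
  rw [coordSub_eq_span, coordFlag]
  congr 1
  ext v
  constructor
  · rintro ⟨r, k, h1, h2, h3, rfl⟩
    exact ⟨k, ⟨r, h1, h2, h3⟩, rfl⟩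
  · rintro ⟨k, ⟨r, h1, h2, h3⟩, rfl⟩
    exact ⟨r, k, h1, h2, h3, rfl⟩

theorem coordFlag_id {n s : ℕ} (d : Fin s → ℕ) (l : Fin s) :
    coordFlag n d id l = coordSub {k | (k : ℕ) + 1 ≤ flagDim d l} := by
  rw [coordFlag_eq]
  congr 1
  ext k
  constructor
  · rintro ⟨r, -, h2, h3⟩
    rw [id_eq] at h3
    rw [Set.mem_ofPred_eq, ← h3]
    exact h2
  · exact fun h => ⟨_, Nat.le_add_left _ _, h, rfl⟩

theorem card_filter_comp {ι : Type*} [Fintype ι] (π : Equiv.Perm ι) (τ : ι → ℕ) (l : ℕ) :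
    (Finset.univ.filter fun i => (τ ∘ π) i ≤ l).card =
      (Finset.univ.filter fun i => τ i ≤ l).card := by
  rw [Finset.card_filter, Finset.card_filter]
  exact Equiv.sum_comp π fun i => if τ i ≤ l then 1 else 0

/-- Sublevel sets of a monotone function are initial segments, hence determined by their size. -/
theorem setOf_le_of_monotone {N : ℕ} {τ : Fin N → ℕ} (hτ : Monotone τ) (l : ℕ) :
    {i | τ i ≤ l} = {i : Fin N | (i : ℕ) + 1 ≤ (Finset.univ.filter fun i => τ i ≤ l).card} := by
  ext i
  simp only [Set.mem_ofPred_eq]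
  constructor
  · intro hi
    have h : Finset.Iic i ⊆ Finset.univ.filter fun i => τ i ≤ l := fun j hj =>
      Finset.mem_filter.2 ⟨Finset.mem_univ _, (hτ (Finset.mem_Iic.1 hj)).trans hi⟩
    simpa using Finset.card_le_card h
  · intro hi
    by_contra hc
    have h : (Finset.univ.filter fun i => τ i ≤ l) ⊆ Finset.Iio i := fun j hj => by
      rw [Finset.mem_Iio]
      by_contra hij
      exact hc ((hτ (not_lt.1 hij)).trans (Finset.mem_filter.1 hj).2)
    have := Finset.card_le_card h
    rw [Fin.card_Iio] at this
    omega

theorem finrank_levelFlag {n s : ℕ} (τ : Fin (2 * n) → ℕ) (l : Fin s) :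
    Module.finrank ℂ (levelFlag s τ l) = (Finset.univ.filter fun i => τ i ≤ l).card := by
  have hset : ((Finset.univ.filter fun i => τ i ≤ l : Finset (Fin (2 * n))) : Set (Fin (2 * n))) =
      {i | τ i ≤ l} := by
    ext i
    simp
  rw [← finrank_coordSub, hset]
  rfl

theorem levelFlag_mem_multiGr {n s : ℕ} {d : Fin s → ℕ} {τ : Fin (2 * n) → ℕ}
    (hcard : ∀ l : Fin s, (Finset.univ.filter fun i => τ i ≤ l).card = flagDim d l) :
    levelFlag s τ ∈ multiGr (2 * n) (flagDim d) :=
  fun l => (finrank_levelFlag τ l).trans (hcard l)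

/-- Symmetric coordinate flags of the right dimensions are conjugate to the standard flag. -/
theorem levelFlag_mem_spFlagVariety {n s : ℕ} {d : Fin s → ℕ} {τ : Fin (2 * n) → ℕ}
    (hτ : ∀ i, τ i + τ (Fin.rev i) = s)
    (hcard : ∀ l : Fin s, (Finset.univ.filter fun i => τ i ≤ l).card = flagDim d l) :
    levelFlag s τ ∈ spFlagVariety n d := by
  induction hμ : ∑ i : Fin (2 * n), (Fin.rev i : ℕ) * τ i using Nat.strong_induction_on
    generalizing τ with
  | _ μ ih =>
    by_cases hmono : Monotone τ
    · refine ⟨1, symplectic_one_mem n, ?_⟩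
      rw [act_one]
      ext1 l
      rw [coordFlag_id, levelFlag, setOf_le_of_monotone hmono, hcard]
    -- An inversion is removed by a reflection, which lowers the weight; the root group identity
    -- shows that the two flags are conjugate under `Sp`.
    · have hex : ∃ a b, a < b ∧ τ b < τ a := by
        by_contra! hc
        refine hmono fun a b hab => ?_
        rcases hab.lt_or_eq with h | rfl
        · exact hc a b h
        · exact le_rfl
      obtain ⟨a, b, hab, hτab⟩ := hex
      have hτa := hτ a
      have hτb := hτ b
      have hlt := sum_mul_reflection_lt (w := fun i => (Fin.rev i : ℕ)) (τ := τ) (a := b) (b := a)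
        (Fin.rev_lt_rev.2 hab) (by simpa using hab) hτab (by omega)
      rw [hμ] at hlt
      obtain ⟨g, hg, hgτ⟩ := ih _ hlt (comp_reflection_symm hτ hab.ne')
        (fun l => by rw [card_filter_comp, hcard]) rfl
      obtain ⟨c, hc⟩ := exists_map_rootMap_levelFlag hτ hτab one_ne_zero
      rw [← act_ofIsometry (formW_rootMap hab.ne' 1), ← act_ofIsometry (formW_rootMap hab.ne c),
        hgτ] at hc
      refine ⟨(ofIsometry _ (formW_rootMap hab.ne' 1))⁻¹ *
        (ofIsometry _ (formW_rootMap hab.ne c) * g), symplectic_mul_mem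
        (symplectic_inv_mem (ofIsometry_mem _)) (symplectic_mul_mem (ofIsometry_mem _) hg), ?_⟩
      rw [act_mul, act_mul, ← hc, ← act_mul, inv_mul_cancel, act_one]

/-! ### Degeneration of coordinate flags -/

/-- The map adds multiples of `e_a` to `e_b` and of `e_{rev b}` to `e_{rev a}`, both towards smaller
indices. -/
theorem ofIsometry_rootMap_mem_borel {n : ℕ} {a b : Fin (2 * n)} (hab : a < b) (c : ℂ) :
    ofIsometry _ (formW_rootMap hab.ne' c) ∈ borel n := by
  intro i j hij
  change LinearMap.toMatrix' (rootMap b a c) i j = 0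
  rw [LinearMap.toMatrix'_apply, rootMap_apply]
  have e1 : (if i = a then formSign n b * (Pi.single j (1 : ℂ) : Fin (2 * n) → ℂ) b else 0) = 0 := by
    split_ifs with h
    · rw [Pi.single_eq_of_ne, mul_zero]
      rintro rfl
      exact absurd hij (not_lt.2 (h ▸ hab.le))
    · rfl
  have e2 : (if i = Fin.rev b then
      formSign n a * (Pi.single j (1 : ℂ) : Fin (2 * n) → ℂ) (Fin.rev a) else 0) = 0 := by
    split_ifs with h
    · rw [Pi.single_eq_of_ne, mul_zero]
      intro h'
      rw [← h', h, Fin.rev_lt_rev] at hij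
      exact absurd hij (not_lt.2 hab.le)
    · rfl
  simp only [e1, e2, Pi.single_eq_of_ne hij.ne', sub_zero, mul_zero, add_zero]

/-- The indices of the coordinate flag `σ_d`: the generic position relative to the standard flag. -/
def genericSet {n : ℕ} (k : ℕ) : Finset (Fin (2 * n)) :=
  Finset.univ.filter fun i => (i : ℕ) + 1 < k ∨ n ≤ (i : ℕ) ∧ (i : ℕ) < n + k

theorem mem_genericSet {n k : ℕ} {i : Fin (2 * n)} :
    i ∈ genericSet k ↔ (i : ℕ) + 1 < k ∨ n ≤ (i : ℕ) ∧ (i : ℕ) < n + k := by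
  simp [genericSet]

theorem card_genericSet {n k : ℕ} (hk : 1 ≤ k) (hkn : k ≤ n) :
    (genericSet k : Finset (Fin (2 * n))).card = 2 * k - 1 := by
  have h : (genericSet k : Finset (Fin (2 * n))).image Fin.val =
      Finset.range (k - 1) ∪ Finset.Ico n (n + k) := by
    ext i
    simp only [Finset.mem_image, mem_genericSet, Finset.mem_union, Finset.mem_range,
      Finset.mem_Ico]
    constructor
    · rintro ⟨j, hj, rfl⟩
      omega
    · intro hi
      exact ⟨⟨i, by omega⟩, by simp only; omega, rfl⟩
  rw [← Finset.card_image_of_injective _ Fin.val_injective, h, Finset.card_union_of_disjoint,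
    Finset.card_range, Nat.card_Ico]
  · omega
  · rw [Finset.disjoint_left]
    intro i hi hi'
    rw [Finset.mem_range] at hi
    rw [Finset.mem_Ico] at hi'
    omega

section Climb

variable {n s : ℕ} {d : Fin s → ℕ} {τ : Fin (2 * n) → ℕ}

/-- The upper bound is the lower bound `hlow` for the dual index and the dual member. -/
theorem lt_of_level_le (hsym : ∀ l, d l + d (Fin.rev l) = n + 1)
    (hτ : ∀ i, τ i + τ (Fin.rev i) = s)
    (hlow : ∀ (i : Fin (2 * n)) (l : Fin s), (i : ℕ) + 1 < d l → τ i ≤ l) (i : Fin (2 * n))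
    (l : Fin s) (hi : τ i ≤ l) : (i : ℕ) < n + d l := by
  by_contra hc
  have h1 := hsym l
  have h2 := hτ i
  have h3 := l.2
  have h4 := i.2
  have := hlow (Fin.rev i) (Fin.rev l) (by rw [Fin.val_rev]; omega)
  rw [Fin.val_rev] at this
  omega

/-- A count: the member has as many indices as the generic set, contains its low part, and stays
below `n + d l`. So a superfluous index below `n` occurs exactly when an index of the upper part is
missing. -/
theorem exists_low_iff_exists_high (hd : ∀ l, 1 ≤ d l ∧ d l ≤ n)
    (hsym : ∀ l, d l + d (Fin.rev l) = n + 1) (hτ : ∀ i, τ i + τ (Fin.rev i) = s)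
    (hcard : ∀ l : Fin s, (Finset.univ.filter fun i => τ i ≤ l).card = flagDim d l)
    (hlow : ∀ (i : Fin (2 * n)) (l : Fin s), (i : ℕ) + 1 < d l → τ i ≤ l) (l : Fin s) :
    (∃ a : Fin (2 * n), (a : ℕ) < n ∧ τ a ≤ l ∧ d l ≤ (a : ℕ) + 1) ↔
      ∃ b : Fin (2 * n), n ≤ (b : ℕ) ∧ (b : ℕ) < n + d l ∧ (l : ℕ) < τ b := by
  have hc : (genericSet (d l) : Finset (Fin (2 * n))).card =
      (Finset.univ.filter fun i => τ i ≤ l).card := by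
    rw [hcard, card_genericSet (hd l).1 (hd l).2, flagDim]
  constructor
  · rintro ⟨a, ha, hal, had⟩
    by_contra! hb
    have hsub : genericSet (d l) ⊆ Finset.univ.filter fun i => τ i ≤ l := fun i hi => by
      rw [Finset.mem_filter]
      refine ⟨Finset.mem_univ _, ?_⟩
      rcases mem_genericSet.1 hi with h | h
      · exact hlow i l h
      · exact hb i h.1 h.2
    have heq := Finset.eq_of_subset_of_card_le hsub hc.ge
    have : a ∈ genericSet (d l) := by
      rw [heq]
      exact Finset.mem_filter.2 ⟨Finset.mem_univ _, hal⟩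
    rw [mem_genericSet] at this
    omega
  · rintro ⟨b, hb, hbd, hbl⟩
    by_contra! ha
    have hsub : (Finset.univ.filter fun i => τ i ≤ l) ⊆ genericSet (d l) := fun i hi => by
      have hi' := (Finset.mem_filter.1 hi).2
      rw [mem_genericSet]
      have h1 := ha i
      have h2 := lt_of_level_le hsym hτ hlow i l hi'
      omega
    have heq := Finset.eq_of_subset_of_card_le hsub hc.le
    have : b ∈ Finset.univ.filter fun i => τ i ≤ l := by
      rw [heq, mem_genericSet]
      exact Or.inr ⟨hb, hbd⟩
    have := (Finset.mem_filter.1 this).2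
    omega

/-- A coordinate flag in non-generic position admits a reflection towards the generic position. -/
theorem exists_reflection (hmono : StrictMono d) (hd : ∀ l, 1 ≤ d l ∧ d l ≤ n)
    (hsym : ∀ l, d l + d (Fin.rev l) = n + 1) (hτ : ∀ i, τ i + τ (Fin.rev i) = s)
    (hcard : ∀ l : Fin s, (Finset.univ.filter fun i => τ i ≤ l).card = flagDim d l)
    (hlow : ∀ (i : Fin (2 * n)) (l : Fin s), (i : ℕ) + 1 < d l → τ i ≤ l)
    (hbad : ∃ (a : Fin (2 * n)) (l : Fin s), (a : ℕ) < n ∧ τ a ≤ l ∧ d l ≤ (a : ℕ) + 1) :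
    ∃ a b : Fin (2 * n), (a : ℕ) < n ∧ n ≤ (b : ℕ) ∧ τ a < τ b ∧
      ∀ l : Fin s, τ a ≤ l → (l : ℕ) < τ b → d l ≤ (a : ℕ) + 1 ∧ (b : ℕ) < n + d l := by
  classical
  let S : Finset (Fin (2 * n)) := Finset.univ.filter fun a =>
    ∃ l : Fin s, (a : ℕ) < n ∧ τ a ≤ l ∧ d l ≤ (a : ℕ) + 1
  have hS : S.Nonempty := by
    obtain ⟨a, ha⟩ := hbad
    exact ⟨a, Finset.mem_filter.2 ⟨Finset.mem_univ _, ha⟩⟩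
  -- Start from the superfluous index that enters first, at step `p`; some `b` of the upper part is
  -- then missing at `p`.
  obtain ⟨a, ha, hmin⟩ := Finset.exists_min_image S τ hS
  obtain ⟨l₀, han, hal, had⟩ := (Finset.mem_filter.1 ha).2
  have hps : τ a < s := hal.trans_lt l₀.2
  let p : Fin s := ⟨τ a, hps⟩
  have hpl : d p ≤ d l₀ := hmono.monotone (show p ≤ l₀ from hal)
  obtain ⟨b, hbn, hbd, hbp⟩ := (exists_low_iff_exists_high hd hsym hτ hcard hlow p).1
    ⟨a, han, le_rfl, hpl.trans had⟩
  have hbs := hτ b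
  have hbp' : τ a < τ b := hbp
  let q : Fin s := ⟨τ b - 1, by omega⟩
  have hqv : (q : ℕ) = τ b - 1 := rfl
  have hpq : d p ≤ d q := hmono.monotone (show p ≤ q by
    rw [Fin.le_def]; change τ a ≤ τ b - 1; omega)
  -- At `q`, the last step before `b` enters, `b` is still missing, so some `a'` is superfluous
  -- there. By minimality `a'` enters no earlier than `p`; monotonicity of `d` between `p` and `q`
  -- then gives both bounds for the pair `a', b`.
  obtain ⟨a', ha'n, ha'q, ha'd⟩ := (exists_low_iff_exists_high hd hsym hτ hcard hlow q).2
    ⟨b, hbn, by omega, by omega⟩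
  have ha' := hmin a' (Finset.mem_filter.2 ⟨Finset.mem_univ _, q, ha'n, ha'q, ha'd⟩)
  refine ⟨a', b, ha'n, hbn, by omega, fun l hl hlb => ?_⟩
  have h1 : d l ≤ d q := hmono.monotone (show l ≤ q by rw [Fin.le_def]; omega)
  have h2 : d p ≤ d l := hmono.monotone (show p ≤ l by
    rw [Fin.le_def]; change τ a ≤ l; omega)
  omega

/-- Only `a` and `rev b` are delayed by the reflection. At the steps where `a` is lost it is
superfluous, by `hab`; the case of `rev b` is the dual statement. -/
theorem reflection_low (hd : ∀ l, 1 ≤ d l ∧ d l ≤ n)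
    (hsym : ∀ l, d l + d (Fin.rev l) = n + 1) (hτ : ∀ i, τ i + τ (Fin.rev i) = s)
    (hlow : ∀ (i : Fin (2 * n)) (l : Fin s), (i : ℕ) + 1 < d l → τ i ≤ l)
    {a b : Fin (2 * n)} (ha : (a : ℕ) < n) (hb : n ≤ (b : ℕ))
    (hab : ∀ l : Fin s, τ a ≤ l → (l : ℕ) < τ b → d l ≤ (a : ℕ) + 1 ∧ (b : ℕ) < n + d l)
    (i : Fin (2 * n)) (l : Fin s) (hi : (i : ℕ) + 1 < d l) : (τ ∘ reflection a b) i ≤ l := by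
  have hne : a ≠ b := fun h => by rw [h] at ha; omega
  have h1 := hd l
  have h2 := hsym l
  have h3 := hlow i l hi
  have hτa := hτ a
  have hτb := hτ b
  have hb2 := b.2
  have hl := l.2
  rw [Function.comp_apply, reflection_apply hne]
  split_ifs with c1 c2 c3 c4
  · subst c1
    by_contra hc
    have := hab l h3 (by omega)
    omega
  · subst c2
    omega
  · subst c3
    rw [Fin.val_rev] at hi
    omega
  · subst c4
    by_contra hc
    rw [Fin.val_rev] at hi
    have := hab (Fin.rev l) (by rw [Fin.val_rev]; omega) (by rw [Fin.val_rev]; omega)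
    omega
  · exact h3

/-- The coordinate flags within the bounds of the generic one are degenerations of it. -/
theorem act_levelFlag_mem_zariskiClosure (hmono : StrictMono d) (hd : ∀ l, 1 ≤ d l ∧ d l ≤ n)
    (hsym : ∀ l, d l + d (Fin.rev l) = n + 1) (hτ : ∀ i, τ i + τ (Fin.rev i) = s)
    (hcard : ∀ l : Fin s, (Finset.univ.filter fun i => τ i ≤ l).card = flagDim d l)
    (hlow : ∀ (i : Fin (2 * n)) (l : Fin s), (i : ℕ) + 1 < d l → τ i ≤ l)
    {g : SL n} (hg : g ∈ borel n ∩ symplectic n) :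
    act g (levelFlag s τ) ∈ zariskiClosure (flagDim d)
      (orbitOf (borel n ∩ symplectic n) fun l =>
        coordSub ((genericSet (d l) : Finset (Fin (2 * n))) : Set (Fin (2 * n)))) := by
  induction hμ : ∑ i : Fin (2 * n), (i : ℕ) * τ i using Nat.strong_induction_on
    generalizing τ g with
  | _ μ ih =>
    by_cases hbad : ∃ (a : Fin (2 * n)) (l : Fin s), (a : ℕ) < n ∧ τ a ≤ l ∧ d l ≤ (a : ℕ) + 1
    · obtain ⟨a, b, ha, hb, hτab, hgood⟩ := exists_reflection hmono hd hsym hτ hcard hlow hbad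
      have hab : a < b := by rw [Fin.lt_def]; omega
      have hτa := hτ a
      have hτb := hτ b
      have hlt := sum_mul_reflection_lt (w := fun i => (i : ℕ)) (τ := τ) hab
        (Fin.rev_lt_rev.2 hab) hτab (by omega)
      rw [hμ] at hlt
      refine ⟨act_mem_multiGr g (levelFlag_mem_multiGr hcard), fun F δ hF hv => ?_⟩
      -- The curve `u ↦ g ∘ rootMap a b u` is affine in `u` and equals `g` at `u = 0`.
      have hlin : ∀ u : ℂ, Matrix.toLin' g.1 + u • (Matrix.toLin' g.1 ∘ₗ
          (rootMap a b 1 - LinearMap.id)) = Matrix.toLin' g.1 ∘ₗ rootMap a b u := by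
        intro u
        apply LinearMap.ext
        intro v
        have : rootMap a b u v = v + u • (rootMap a b 1 v - v) := by
          simp only [rootMap, siegelMap_apply, one_smul, add_sub_cancel_left]
        simp only [LinearMap.add_apply, LinearMap.smul_apply, LinearMap.comp_apply, this,
          LinearMap.sub_apply, LinearMap.id_apply, map_add, map_smul]
      refine vanishesAt_of_curve hF (levelFlag_mem_multiGr hcard) (Matrix.toLin' g.1)
        (Matrix.toLin' g.1 ∘ₗ (rootMap a b 1 - LinearMap.id)) (fun u => ?_) fun u hu => ?_
      · rw [hlin]
        exact (toLin'_SL_injective g).comp (rootMap_injective hab.ne u)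
      -- For `u ≠ 0` the point is in the `B^ι`-orbit of the reflected flag, since `rootMap b a c` is
      -- upper triangular; the induction hypothesis applies there.
      · obtain ⟨c, hc⟩ := exists_map_rootMap_levelFlag hτ hτab hu
        have heq : (fun l => (levelFlag s τ l).map (Matrix.toLin' g.1 + u • (Matrix.toLin' g.1 ∘ₗ
            (rootMap a b 1 - LinearMap.id)))) =
            act (g * ofIsometry _ (formW_rootMap hab.ne' c)) (levelFlag s (τ ∘ reflection a b)) := by
          rw [act_mul, act_ofIsometry, ← hc]
          ext1 l
          rw [hlin, Submodule.map_comp]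
          rfl
        rw [heq]
        refine (ih _ hlt (comp_reflection_symm hτ hab.ne) (fun l => by rw [card_filter_comp, hcard])
          (reflection_low hd hsym hτ hlow ha hb hgood) ?_ rfl).2 F δ hF hv
        exact ⟨borel_mul_mem hg.1 (ofIsometry_rootMap_mem_borel hab c),
          symplectic_mul_mem hg.2 (ofIsometry_mem _)⟩
    · push Not at hbad
      -- With no superfluous low index the flag is generic: applied to `rev i` and `rev l`, `hbad`
      -- says that no upper index is missing.
      have heq : levelFlag s τ = fun l =>
          coordSub ((genericSet (d l) : Finset (Fin (2 * n))) : Set (Fin (2 * n))) := by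
        ext1 l
        rw [levelFlag]
        congr 1
        ext i
        rw [Finset.mem_coe, mem_genericSet, Set.mem_ofPred_eq]
        have h1 := hbad i l
        have h2 := lt_of_level_le hsym hτ hlow i l
        have h3 := hlow i l
        have h4 := hbad (Fin.rev i) (Fin.rev l)
        have h5 := hτ i
        have h6 := hsym l
        have h7 := hd l
        have h8 := i.2
        have h9 := l.2
        simp only [Fin.val_rev] at h4
        omega
      rw [heq]
      refine subset_zariskiClosure ?_ ⟨g, hg, rfl⟩
      rintro _ ⟨g', -, rfl⟩
      rw [← heq]
      exact act_mem_multiGr g' (levelFlag_mem_multiGr hcard)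

end Climb

/-! ### The flag of the permutation `σ_d` -/

/-- As `d` increases, the `l` with `2 * d l ≤ r` form an initial segment, whose length is
`blockIndex d r`. -/
theorem lt_blockIndex_iff {s : ℕ} {d : Fin s → ℕ} (hmono : StrictMono d) (r : ℕ) (l : Fin s) :
    (l : ℕ) < blockIndex d r ↔ 2 * d l ≤ r := by
  have h := setOf_le_of_monotone (τ := fun l => 2 * d l)
    (fun i j hij => Nat.mul_le_mul_left 2 (hmono.monotone hij)) r
  have h' := Set.ext_iff.1 h l
  simp only [Set.mem_ofPred_eq] at h'
  rw [h']
  rfl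

/-- Index shift: `d i` is the term `d_{i+1}` of the extended sequence, so block `i` runs from `2 *
extDim n d i` to `2 * d i - 1`. -/
theorem extDim_succ {n s : ℕ} (d : Fin s → ℕ) (i : Fin s) : extDim n d (i + 1) = d i := by
  simp [extDim]

theorem blockIndex_eq {n s : ℕ} {d : Fin s → ℕ} (hmono : StrictMono d) {r : ℕ} {i : Fin s}
    (h1 : 2 * extDim n d i ≤ r) (h2 : r < 2 * d i) : blockIndex d r = i := by
  have hi := lt_blockIndex_iff hmono r i
  rcases Nat.eq_zero_or_pos (i : ℕ) with h0 | h0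
  · omega
  · let j : Fin s := ⟨i - 1, by omega⟩
    have hj := lt_blockIndex_iff hmono r j
    have hji : extDim n d i = d j := by
      rw [← extDim_succ (n := n) d j]
      congr 1
      change (i : ℕ) = i - 1 + 1
      omega
    have hjv : (j : ℕ) = i - 1 := rfl
    rw [hji] at h1
    omega

/-- Take the least `i` with `t < d i`; for `i = 0` the lower bound is `d_0 = 0`. -/
theorem exists_block {n s : ℕ} {d : Fin s → ℕ} {t : ℕ} {l : Fin s}
    (ht : t < d l) : ∃ i ≤ l, extDim n d i ≤ t ∧ t < d i := by
  classical
  obtain ⟨i, hi, hmin⟩ := Finset.exists_min_image (Finset.univ.filter fun i => t < d i) id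
    ⟨l, Finset.mem_filter.2 ⟨Finset.mem_univ _, ht⟩⟩
  refine ⟨i, hmin l (Finset.mem_filter.2 ⟨Finset.mem_univ _, ht⟩), ?_, (Finset.mem_filter.1 hi).2⟩
  rcases Nat.eq_zero_or_pos (i : ℕ) with h0 | h0
  · simp [extDim, h0]
  · let j : Fin s := ⟨i - 1, by omega⟩
    have hji : extDim n d i = d j := by
      rw [← extDim_succ (n := n) d j]
      congr 1
      change (i : ℕ) = i - 1 + 1
      omega
    rw [hji]
    by_contra hc
    have : i ≤ j := hmin j (Finset.mem_filter.2 ⟨Finset.mem_univ _, not_le.1 hc⟩)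
    rw [Fin.le_def] at this
    change (i : ℕ) ≤ i - 1 at this
    omega

theorem sigma_eq {n s : ℕ} {d : Fin s → ℕ} (hmono : StrictMono d) {r : ℕ} {i : Fin s}
    (h1 : 2 * extDim n d i ≤ r) (h2 : r < 2 * d i) :
    sigma n d r = if r < extDim n d i + d i then r - extDim n d i else n + 1 + r - d i := by
  rw [sigma, blockIndex_eq hmono h1 h2, extDim_succ]

/-- The two halves of block `i` go to the labels `d_i, …, d_{i+1} - 1` and `n + 1 + d_i, …, n +
d_{i+1}`. The blocks up to `2 d_l - 1` therefore fill `1, …, d_l - 1` and `n + 1, …, n + d_l`. -/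
theorem coordFlag_sigma {n s : ℕ} {d : Fin s → ℕ} (hmono : StrictMono d) :
    coordFlag n d (sigma n d) =
      fun l => coordSub ((genericSet (d l) : Finset (Fin (2 * n))) : Set (Fin (2 * n))) := by
  ext1 l
  rw [coordFlag_eq]
  congr 1
  ext k
  rw [Set.mem_ofPred_eq, Finset.mem_coe, mem_genericSet]
  constructor
  · rintro ⟨r, hr1, hr2, hr⟩
    rw [flagDim] at hr2
    obtain ⟨i, hil, hi1, hi2⟩ := exists_block (n := n) (d := d) (t := r / 2) (l := l) (by omega)
    rw [sigma_eq hmono (i := i) (by omega) (by omega)] at hr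
    have hdil : d i ≤ d l := hmono.monotone hil
    split_ifs at hr <;> omega
  · intro hk
    rcases hk with hk | ⟨hk1, hk2⟩
    · obtain ⟨i, hil, hi1, hi2⟩ := exists_block (n := n) (d := d) (t := k + 1) (l := l) (by omega)
      have hdil : d i ≤ d l := hmono.monotone hil
      refine ⟨k + 1 + extDim n d i, by omega, by rw [flagDim]; omega, ?_⟩
      rw [sigma_eq hmono (i := i) (by omega) (by omega), if_pos (by omega)]
      omega
    · obtain ⟨i, hil, hi1, hi2⟩ := exists_block (n := n) (d := d) (t := k - n) (l := l) (by omega)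
      have hdil : d i ≤ d l := hmono.monotone hil
      refine ⟨k - n + d i, by omega, by rw [flagDim]; omega, ?_⟩
      rw [sigma_eq hmono (i := i) (by omega) (by omega), if_neg (by omega)]
      omega

/-! ### The Schubert variety as a variety of flags with bounds -/

/-- The flags that are fixed by the involution and satisfy `y l ≤ ⟨e_1, …, e_{n + d l}⟩`. -/
def boundedFlags {s : ℕ} (n : ℕ) (d : Fin s → ℕ) : Set (Tuple s (2 * n)) :=
  {y | y ∈ multiGr (2 * n) (flagDim d) ∧ Monotone y ∧
    (∀ l, y l ≤ coordSub {i | (i : ℕ) < n + d l}) ∧ iota (formW n) y = y}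

theorem act_mono {n s : ℕ} (g : SL n) {x : Tuple s (2 * n)} (hx : Monotone x) :
    Monotone (act g x) := fun _ _ h => Submodule.map_mono (hx h)

theorem borel_map_le {n : ℕ} {g : SL n} (hg : g ∈ borel n) (j : ℕ)
    {U : Submodule ℂ (Fin (2 * n) → ℂ)} (hU : U ≤ coordSub {i | (i : ℕ) < j}) :
    U.map (Matrix.toLin' g.1) ≤ coordSub {i | (i : ℕ) < j} := by
  rintro _ ⟨v, hv, rfl⟩ i hi
  rw [Set.mem_ofPred_eq, not_lt] at hi
  exact apply_eq_zero_of_borel hg (fun k hk => hU hv k (by simpa using hk)) i hi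

/-- A tuple of the right dimensions that is isotropic is fixed by the involution. -/
theorem iota_eq_self_of_isotropic {N s : ℕ} {e : Fin s → ℕ} {b : LinearMap.BilinForm ℂ (Fin N → ℂ)}
    (hb : b.Nondegenerate) (he : ∀ l, e l + e (Fin.rev l) = N) {x : Tuple s N}
    (hx : x ∈ multiGr N e) (h : ∀ l, ∀ u ∈ x (Fin.rev l), ∀ v ∈ x l, b u v = 0) :
    iota b x = x := by
  ext1 l
  symm
  apply Submodule.eq_of_le_of_finrank_eq
  · exact fun v hv u hu => h l u hu v hv
  · rw [iota, LinearMap.BilinForm.finrank_orthogonal hb, hx, hx, Module.finrank_fin_fun]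
    have := he l
    omega

section Schubert

variable {n s : ℕ} {d : Fin s → ℕ}

theorem act_mem_boundedFlags {g : SL n} (hg : g ∈ borel n ∩ symplectic n) {y : Tuple s (2 * n)}
    (hy : y ∈ boundedFlags n d) : act g y ∈ boundedFlags n d :=
  ⟨act_mem_multiGr g hy.1, act_mono g hy.2.1, fun l => borel_map_le hg.1 _ (hy.2.2.1 l),
    by rw [iota_act hg.2, hy.2.2.2]⟩

/-- The lower bound is the orthogonal of the upper bound for the dual member. -/
theorem le_of_mem_boundedFlags (hsym : ∀ l, d l + d (Fin.rev l) = n + 1) {y : Tuple s (2 * n)}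
    (hy : y ∈ boundedFlags n d) (l : Fin s) : coordSub {i | (i : ℕ) + 1 < d l} ≤ y l := by
  rw [← iota_eq_self_iff.1 hy.2.2.2 l]
  refine le_trans ?_ (LinearMap.BilinForm.orthogonal_le (hy.2.2.1 (Fin.rev l)))
  rw [orthogonal_coordSub, coordSub_mono]
  intro i hi
  have := hsym l
  have := i.2
  simp only [Set.mem_ofPred_eq, Fin.val_rev] at hi ⊢
  omega

theorem isZariskiClosed_boundedFlags (hsym : ∀ l, d l + d (Fin.rev l) = n + 1)
    (hd : ∀ l, 1 ≤ d l) : IsZariskiClosed (flagDim d) (boundedFlags n d) := by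
  refine Set.Subset.antisymm (fun y hy => ?_) (subset_zariskiClosure fun y hy => hy.1)
  have hι : iota (formW n) y = y := by
    refine iota_eq_self_of_isotropic (formW_nondegenerate n) (e := flagDim d) (fun l => ?_) hy.1
      fun l => bilin_eq_zero_of_mem_zariskiClosure (formW n) _ _ (fun x hx u hu v hv => ?_) hy
    · have := hsym l
      have := hd l
      have := hd (Fin.rev l)
      simp only [flagDim]
      omega
    · rw [← iota_eq_self_iff.1 hx.2.2.2 l] at hv
      exact hv u hu
  refine ⟨hy.1, fun l l' hll' => ?_, fun l v hv i hi => ?_, hι⟩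
  -- Since `y l'` is the orthogonal of `y (rev l')`, the containment `y l ≤ y l'` is an
  -- orthogonality relation, hence closed.
  · rw [← iota_eq_self_iff.1 hι l']
    refine fun v hv u hu => bilin_eq_zero_of_mem_zariskiClosure (formW n) _ _
      (fun x hx u hu v hv => ?_) hy u hu v hv
    have hv' := hx.2.1 hll' hv
    rw [← iota_eq_self_iff.1 hx.2.2.2 l'] at hv'
    exact hv' u hu
  · exact apply_eq_zero_of_mem_zariskiClosure l i (fun x hx u hu => hx.2.2.1 l hu i hi) hy v hv

theorem coordFlag_id_mono (hmono : StrictMono d) : Monotone (coordFlag n d id) := by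
  intro l l' hll'
  rw [coordFlag_id, coordFlag_id, coordSub_mono]
  intro i hi
  have := hmono.monotone hll'
  simp only [Set.mem_ofPred_eq, flagDim] at hi ⊢
  omega

theorem iota_coordFlag_id (hsym : ∀ l, d l + d (Fin.rev l) = n + 1) (hd : ∀ l, 1 ≤ d l) :
    iota (formW n) (coordFlag n d id) = coordFlag n d id := by
  rw [iota_eq_self_iff]
  intro l
  rw [coordFlag_id, coordFlag_id, orthogonal_coordSub]
  congr 1
  ext i
  have := hsym l
  have := hd l
  have := hd (Fin.rev l)
  have := i.2
  simp only [Set.mem_ofPred_eq, flagDim, Fin.val_rev]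
  omega

/-- The upper bound holds at the flag of `σ_d`, is stable under `B`, and is closed. -/
theorem schubertFixed_subset (hmono : StrictMono d) (hd : ∀ l, 1 ≤ d l ∧ d l ≤ n) :
    schubertFixed n d (sigma n d) ⊆ boundedFlags n d := by
  rintro y ⟨⟨⟨g, -, rfl⟩, hcl⟩, hι⟩
  refine ⟨hcl.1, act_mono g (coordFlag_id_mono hmono), fun l v hv i hi => ?_, hι⟩
  refine apply_eq_zero_of_mem_zariskiClosure l i ?_ hcl v hv
  rintro _ ⟨g', hg', rfl⟩ u hu
  refine borel_map_le hg' (n + d l) ?_ hu i hi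
  rw [coordFlag_sigma hmono, coordSub_mono]
  intro j hj
  rw [Finset.mem_coe, mem_genericSet] at hj
  have := hd l
  rw [Set.mem_ofPred_eq]
  omega

/-- Enlarging `B^ι` to `B` enlarges the closure, and `Sp` carries the `ι`-fixed standard flag to
`ι`-fixed flags. -/
theorem schubertSp_subset (hsym : ∀ l, d l + d (Fin.rev l) = n + 1) (hd : ∀ l, 1 ≤ d l) :
    schubertSp n d (sigma n d) ⊆ schubertFixed n d (sigma n d) := by
  rintro y ⟨⟨g, hg, rfl⟩, hcl⟩
  refine ⟨⟨⟨g, Set.mem_univ _, rfl⟩, zariskiClosure_mono ?_ hcl⟩, ?_⟩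
  · rintro _ ⟨g', hg', rfl⟩
    exact ⟨g', hg'.1, rfl⟩
  · rw [iota_act hg, iota_coordFlag_id hsym hd]

/-- Bruhat decomposition reduces to a coordinate flag, on which the bounds become `hlow`; the
degeneration argument and conjugacy to the standard flag then apply. -/
theorem boundedFlags_subset (hmono : StrictMono d) (hd : ∀ l, 1 ≤ d l ∧ d l ≤ n)
    (hsym : ∀ l, d l + d (Fin.rev l) = n + 1) :
    boundedFlags n d ⊆ schubertSp n d (sigma n d) := by
  intro y hy
  have hlow' := le_of_mem_boundedFlags hsym hy
  obtain ⟨τ, hτs, hτ, g, hg, rfl⟩ := exists_eq_act_levelFlag hy.2.1 hy.2.2.2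
  have hcard : ∀ l : Fin s, (Finset.univ.filter fun i => τ i ≤ l).card = flagDim d l := by
    intro l
    rw [← finrank_levelFlag, ← hy.1 l]
    exact (Submodule.equivMapOfInjective _ (toLin'_SL_injective g) _).finrank_eq
  have hlow : ∀ (i : Fin (2 * n)) (l : Fin s), (i : ℕ) + 1 < d l → τ i ≤ l := by
    intro i l hi
    refine (hτ i l).2 ⟨Pi.single i 1, hlow' l (single_mem_coordSub.2 hi), Pi.single_eq_same _ _,
      fun j hj => Pi.single_eq_of_ne hj.ne' _⟩
  refine ⟨?_, ?_⟩
  · obtain ⟨g', hg', h⟩ := levelFlag_mem_spFlagVariety hτs hcard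
    exact ⟨g * g', symplectic_mul_mem hg.2 hg', by rw [h, act_mul]⟩
  · rw [coordFlag_sigma hmono]
    exact act_levelFlag_mem_zariskiClosure hmono hd hsym hτs hcard hlow hg

theorem schubertFixed_eq_boundedFlags (hmono : StrictMono d) (hd : ∀ l, 1 ≤ d l ∧ d l ≤ n)
    (hsym : ∀ l, d l + d (Fin.rev l) = n + 1) :
    schubertFixed n d (sigma n d) = boundedFlags n d :=
  (schubertFixed_subset hmono hd).antisymm
    ((boundedFlags_subset hmono hd hsym).trans (schubertSp_subset hsym fun l => (hd l).1))

theorem schubertSp_eq_boundedFlags (hmono : StrictMono d) (hd : ∀ l, 1 ≤ d l ∧ d l ≤ n)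
    (hsym : ∀ l, d l + d (Fin.rev l) = n + 1) :
    schubertSp n d (sigma n d) = boundedFlags n d :=
  ((schubertSp_subset hsym fun l => (hd l).1).trans (schubertFixed_subset hmono hd)).antisymm
    (boundedFlags_subset hmono hd hsym)

end Schubert

/-! ### The embedding of the degenerate flag variety -/

section Embedding

variable {n s : ℕ} {b : LinearMap.BilinForm ℂ (Fin (n + 1) → ℂ)}

/-- The index of the vector of `W` to which the `k`-th basis vector of the copy of `V` at `d` is
sent. -/
def target (hn : 1 ≤ n) {d : ℕ} (hd : d ≤ n) (k : Fin (n + 1)) : Fin (2 * n) :=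
  if h : d ≤ (k : ℕ) + 1 then ⟨k, by omega⟩ else ⟨n + 1 + k, by omega⟩

theorem target_val (hn : 1 ≤ n) {d : ℕ} (hd : d ≤ n) (k : Fin (n + 1)) :
    (target hn hd k : ℕ) = if d ≤ (k : ℕ) + 1 then (k : ℕ) else n + 1 + k := by
  unfold target
  split_ifs <;> rfl

theorem target_injective (hn : 1 ≤ n) {d : ℕ} (hd : d ≤ n) :
    Function.Injective (target hn hd) := by
  intro k k' h
  have h' := congrArg Fin.val h
  rw [target_val, target_val] at h'
  have := k.2
  have := k'.2
  ext
  split_ifs at h' <;> omega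

/-- Together with `exists_target`: the copy of `V` at `d` occupies exactly the labels `d, …, n + d`,
a complement of `F_{d-1}` in `F_{n+d}`. -/
theorem target_bounds (hn : 1 ≤ n) {d : ℕ} (hd1 : 1 ≤ d) (hd : d ≤ n) (k : Fin (n + 1)) :
    d ≤ (target hn hd k : ℕ) + 1 ∧ (target hn hd k : ℕ) < n + d := by
  have := k.2
  rw [target_val]
  split_ifs <;> omega

theorem exists_target (hn : 1 ≤ n) {d : ℕ} (hd : d ≤ n) {i : Fin (2 * n)} (h1 : d ≤ (i : ℕ) + 1)
    (h2 : (i : ℕ) < n + d) : ∃ k, target hn hd k = i := by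
  by_cases hi : (i : ℕ) ≤ n
  · refine ⟨⟨i, by omega⟩, ?_⟩
    ext
    rw [target_val]
    simp only
    rw [if_pos h1]
  · refine ⟨⟨i - (n + 1), by omega⟩, ?_⟩
    ext
    rw [target_val]
    simp only
    rw [if_neg (by omega)]
    omega

theorem dualLabel_bounds (hn : 1 ≤ n) {r : ℕ} (h1 : 1 ≤ r) (h2 : r ≤ n + 1) :
    1 ≤ dualLabel n r ∧ dualLabel n r ≤ n + 1 := by
  unfold dualLabel
  split_ifs <;> omega

/-- The dual index. -/
def dualIndex (hn : 1 ≤ n) (k : Fin (n + 1)) : Fin (n + 1) :=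
  ⟨dualLabel n (k + 1) - 1, by
    have := dualLabel_bounds hn (r := k + 1) (by omega) (by omega)
    omega⟩

theorem eq_dualIndex_iff (hn : 1 ≤ n) (k l : Fin (n + 1)) :
    l = dualIndex hn k ↔ (l : ℕ) + 1 = dualLabel n (k + 1) := by
  have := dualLabel_bounds hn (r := k + 1) (by omega) (by omega)
  rw [Fin.ext_iff, dualIndex]
  simp only
  omega

/-- `f_k` pairs with no other basis vector, so otherwise it would lie in the radical of `b`. -/
theorem dualIndex_ne_zero (hn : 1 ≤ n) (hb : IsSymplecticV n b) (k : Fin (n + 1)) :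
    b (Pi.single k 1) (Pi.single (dualIndex hn k) 1) ≠ 0 := by
  intro h0
  have h : ∀ w, b (Pi.single k 1) w = 0 := by
    intro w
    rw [← Finset.univ_sum_single w, map_sum]
    refine Finset.sum_eq_zero fun i _ => ?_
    have hi : (Pi.single i (w i) : Fin (n + 1) → ℂ) = w i • Pi.single i (1 : ℂ) := by
      rw [← Pi.single_smul, smul_eq_mul, mul_one]
    rw [hi, map_smul]
    by_cases hik : i = dualIndex hn k
    · rw [hik, h0, smul_zero]
    · rw [hb.dual k i fun h => hik ((eq_dualIndex_iff hn k i).2 h), smul_zero]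
  have := congrFun (hb.nondegenerate.1 _ h) k
  simp at this

/-- The scalars that match the form on `V` with the standard form on `W`. -/
def scale (hn : 1 ≤ n) (b : LinearMap.BilinForm ℂ (Fin (n + 1) → ℂ)) (i : Fin (2 * n)) : ℂ :=
  if h : (i : ℕ) < n then
    b (Pi.single ⟨i, h.trans n.lt_succ_self⟩ 1)
      (Pi.single (dualIndex hn ⟨i, h.trans n.lt_succ_self⟩) 1)
  else 1

theorem scale_ne_zero (hn : 1 ≤ n) (hb : IsSymplecticV n b) (i : Fin (2 * n)) :
    scale hn b i ≠ 0 := by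
  unfold scale
  split_ifs
  · exact dualIndex_ne_zero hn hb _
  · exact one_ne_zero

/-- The embedding of the copy of `V` at `d` into `W`. -/
def embed (hn : 1 ≤ n) (b : LinearMap.BilinForm ℂ (Fin (n + 1) → ℂ)) {d : ℕ} (hd : d ≤ n) :
    (Fin (n + 1) → ℂ) →ₗ[ℂ] (Fin (2 * n) → ℂ) :=
  Fintype.linearCombination ℂ fun k => scale hn b (target hn hd k) • Pi.single (target hn hd k) 1

theorem embed_single (hn : 1 ≤ n) {d : ℕ} (hd : d ≤ n) (k : Fin (n + 1)) :
    embed hn b hd (Pi.single k 1) =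
      scale hn b (target hn hd k) • Pi.single (target hn hd k) 1 := by
  rw [embed, Fintype.linearCombination_apply_single, one_smul]

theorem embed_apply_target (hn : 1 ≤ n) {d : ℕ} (hd : d ≤ n) (v : Fin (n + 1) → ℂ)
    (k : Fin (n + 1)) :
    embed hn b hd v (target hn hd k) = scale hn b (target hn hd k) * v k := by
  rw [embed, Fintype.linearCombination_apply, Finset.sum_apply, Finset.sum_eq_single k]
  · simp [mul_comm]
  · intro j _ hj
    simp [(target_injective hn hd).ne hj.symm]
  · simp

theorem embed_apply_of_forall_ne (hn : 1 ≤ n) {d : ℕ} (hd : d ≤ n) (v : Fin (n + 1) → ℂ)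
    {i : Fin (2 * n)} (hi : ∀ k, target hn hd k ≠ i) : embed hn b hd v i = 0 := by
  rw [embed, Fintype.linearCombination_apply, Finset.sum_apply]
  refine Finset.sum_eq_zero fun k _ => ?_
  simp [(hi k).symm]

theorem embed_apply_eq_zero (hn : 1 ≤ n) {d : ℕ} (hd1 : 1 ≤ d) (hd : d ≤ n) (v : Fin (n + 1) → ℂ)
    {i : Fin (2 * n)} (hi : (i : ℕ) + 1 < d ∨ n + d ≤ i) : embed hn b hd v i = 0 := by
  refine embed_apply_of_forall_ne hn hd v fun k hk => ?_
  have := target_bounds hn hd1 hd k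
  rw [hk] at this
  omega

/-- The splitting of `⟨e_1, …, e_{n + d}⟩` into `⟨e_1, …, e_{d - 1}⟩` and the copy of `V` at `d`. -/
def splitting (hn : 1 ≤ n) (hb : IsSymplecticV n b) {d : ℕ} (hd1 : 1 ≤ d) (hd : d ≤ n) :
    Splitting (d - 1) (n + 1) (2 * n) where
  C i := Pi.single ⟨i, by omega⟩ 1
  φ := embed hn b hd
  ρ := LinearMap.funLeft ℂ ℂ fun i : Fin (d - 1) => (⟨i, by omega⟩ : Fin (2 * n))
  ψ := LinearMap.pi fun k =>
    (scale hn b (target hn hd k))⁻¹ • LinearMap.proj (target hn hd k)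
  ρ_C i := by
    ext j
    rw [LinearMap.funLeft_apply, Pi.single_apply, Pi.single_apply]
    simp only [Fin.ext_iff]
  ψ_C i := by
    ext k
    have h : target hn hd k ≠ ⟨i, by omega⟩ := by
      intro h
      have h' := target_bounds hn hd1 hd k
      rw [h] at h'
      have := i.2
      simp only at h'
      omega
    simp [h]
  ρ_φ v := by
    ext j
    rw [LinearMap.funLeft_apply]
    exact embed_apply_eq_zero hn hd1 hd v (Or.inl (by simp only; omega))
  ψ_φ v := by
    ext k
    simp [embed_apply_target, scale_ne_zero hn hb]

theorem span_splitting (hn : 1 ≤ n) (hb : IsSymplecticV n b) {d : ℕ} (hd1 : 1 ≤ d) (hd : d ≤ n) :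
    Submodule.span ℂ (Set.range (splitting hn hb hd1 hd).C) =
      coordSub {i | (i : ℕ) + 1 < d} := by
  rw [coordSub_eq_span]
  congr 1
  ext v
  constructor
  · rintro ⟨i, rfl⟩
    refine ⟨⟨i, by omega⟩, ?_, rfl⟩
    rw [Set.mem_ofPred_eq]
    simp only
    omega
  · rintro ⟨i, hi, rfl⟩
    rw [Set.mem_ofPred_eq] at hi
    exact ⟨⟨i, by omega⟩, rfl⟩

/-- The embedding `V_d ↦ ⟨e_1, …, e_{d - 1}⟩ ⊕ V_d`. -/
def extendSub (hn : 1 ≤ n) (hb : IsSymplecticV n b) {d : ℕ} (hd1 : 1 ≤ d) (hd : d ≤ n)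
    (U : Submodule ℂ (Fin (n + 1) → ℂ)) : Submodule ℂ (Fin (2 * n) → ℂ) :=
  (splitting hn hb hd1 hd).extend U

theorem extendSub_eq (hn : 1 ≤ n) (hb : IsSymplecticV n b) {d : ℕ} (hd1 : 1 ≤ d) (hd : d ≤ n)
    (U : Submodule ℂ (Fin (n + 1) → ℂ)) : extendSub hn hb hd1 hd U =
      coordSub {i | (i : ℕ) + 1 < d} ⊔ U.map (embed hn b hd) := by
  rw [extendSub, Splitting.extend, span_splitting]
  rfl

theorem embed_mem_extendSub_iff (hn : 1 ≤ n) (hb : IsSymplecticV n b) {d : ℕ} (hd1 : 1 ≤ d)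
    (hd : d ≤ n) {U : Submodule ℂ (Fin (n + 1) → ℂ)} {v : Fin (n + 1) → ℂ} :
    embed hn b hd v ∈ extendSub hn hb hd1 hd U ↔ v ∈ U :=
  (splitting hn hb hd1 hd).φ_mem_extend_iff

theorem finrank_extendSub (hn : 1 ≤ n) (hb : IsSymplecticV n b) {d : ℕ} (hd1 : 1 ≤ d)
    (hd : d ≤ n) (U : Submodule ℂ (Fin (n + 1) → ℂ)) :
    Module.finrank ℂ (extendSub hn hb hd1 hd U) = d - 1 + Module.finrank ℂ U :=
  (splitting hn hb hd1 hd).finrank_extend U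

theorem extendSub_le (hn : 1 ≤ n) (hb : IsSymplecticV n b) {d : ℕ} (hd1 : 1 ≤ d)
    (hd : d ≤ n) (U : Submodule ℂ (Fin (n + 1) → ℂ)) :
    extendSub hn hb hd1 hd U ≤ coordSub {i | (i : ℕ) < n + d} := by
  rw [extendSub_eq]
  refine sup_le (coordSub_mono.2 fun i hi => ?_) ?_
  · rw [Set.mem_ofPred_eq] at hi ⊢
    omega
  · rintro _ ⟨v, -, rfl⟩ i hi
    exact embed_apply_eq_zero hn hd1 hd v (Or.inr (by simpa using hi))

/-- A vector of `F_{n+d}` differs from its component in the copy of `V` by an element of `F_{d-1}`,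
which `W` contains. -/
theorem exists_eq_extendSub (hn : 1 ≤ n) (hb : IsSymplecticV n b) {d : ℕ} (hd1 : 1 ≤ d)
    (hd : d ≤ n) {W : Submodule ℂ (Fin (2 * n) → ℂ)} (h1 : coordSub {i | (i : ℕ) + 1 < d} ≤ W)
    (h2 : W ≤ coordSub {i | (i : ℕ) < n + d}) :
    extendSub hn hb hd1 hd (W.map (splitting hn hb hd1 hd).ψ) = W := by
  have key : ∀ w ∈ W, w - embed hn b hd ((splitting hn hb hd1 hd).ψ w) ∈
      coordSub {i : Fin (2 * n) | (i : ℕ) + 1 < d} := by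
    intro w hw i hi
    rw [Set.mem_ofPred_eq, not_lt] at hi
    by_cases hi' : (i : ℕ) < n + d
    · obtain ⟨k, rfl⟩ := exists_target hn hd hi hi'
      rw [Pi.sub_apply, embed_apply_target]
      simp [splitting, scale_ne_zero hn hb]
    · rw [Pi.sub_apply, embed_apply_eq_zero hn hd1 hd _ (Or.inr (not_lt.1 hi')), sub_zero]
      exact h2 hw i hi'
  rw [extendSub_eq]
  apply le_antisymm
  · refine sup_le h1 ?_
    rintro _ ⟨_, ⟨w, hw, rfl⟩, rfl⟩
    have := W.sub_mem hw (h1 (key w hw))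
    rwa [sub_sub_cancel] at this
  · intro w hw
    rw [← sub_add_cancel w (embed hn b hd ((splitting hn hb hd1 hd).ψ w))]
    exact Submodule.add_mem_sup (key w hw) ⟨_, ⟨w, hw, rfl⟩, rfl⟩

/-! ### Compatibility with projections, forms and the torus -/

theorem pr_single (i j : ℕ) (k : Fin (n + 1)) : pr n i j (Pi.single k 1) =
    (if i ≤ (k : ℕ) + 1 ∧ (k : ℕ) + 1 < j then (0 : ℂ) else 1) • Pi.single k 1 := by
  ext l
  rw [pr, Matrix.toLin'_apply, Matrix.mulVec_diagonal, Pi.smul_apply, smul_eq_mul]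
  by_cases h : l = k
  · subst h; rfl
  · rw [Pi.single_eq_of_ne h, mul_zero, mul_zero]

/-- The two embeddings send `f_k` to the same vector unless `d ≤ k < d'`. In that case `pr` kills
`f_k`, and the first embedding sends it to a multiple of `e_k`, which lies in `F_{d'-1}`. -/
theorem embed_sub_embed_pr (hn : 1 ≤ n) {d d' : ℕ} (hd : d ≤ n) (hd' : d' ≤ n) (hdd : d ≤ d')
    (v : Fin (n + 1) → ℂ) : embed hn b hd v - embed hn b hd' (pr n d d' v) ∈
      coordSub {i : Fin (2 * n) | (i : ℕ) + 1 < d'} := by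
  have hsingle : ∀ k, embed hn b hd (Pi.single k 1) - embed hn b hd' (pr n d d' (Pi.single k 1)) ∈
      coordSub {i : Fin (2 * n) | (i : ℕ) + 1 < d'} := by
    intro k
    rw [pr_single, map_smul, embed_single, embed_single]
    by_cases h : d ≤ (k : ℕ) + 1 ∧ (k : ℕ) + 1 < d'
    · rw [if_pos h, zero_smul, sub_zero]
      refine Submodule.smul_mem _ _ (single_mem_coordSub.2 ?_)
      rw [Set.mem_ofPred_eq, target_val, if_pos h.1]
      exact h.2
    -- The scalar depends only on the index in `W`, not on the copy, so equal targets give equal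
    -- images.
    · have ht : target hn hd k = target hn hd' k := by
        ext
        rw [target_val, target_val]
        split_ifs <;> omega
      rw [if_neg h, one_smul, ht, sub_self]
      exact Submodule.zero_mem _
  have hlin : (⊤ : Submodule ℂ (Fin (n + 1) → ℂ)) ≤
      (coordSub {i : Fin (2 * n) | (i : ℕ) + 1 < d'}).comap
        (embed hn b hd - embed hn b hd' ∘ₗ pr n d d') := by
    rw [← (Pi.basisFun ℂ (Fin (n + 1))).span_eq, Submodule.span_le]
    rintro _ ⟨k, rfl⟩
    rw [Pi.basisFun_apply]
    exact hsingle k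
  exact hlin (Submodule.mem_top (x := v))

/-- The larger subspace contains `F_{d'-1}`, and modulo `F_{d'-1}` the embedding at `d` is that at
`d'` after `pr`. -/
theorem extendSub_le_extendSub_iff (hn : 1 ≤ n) (hb : IsSymplecticV n b) {d d' : ℕ} (hd1 : 1 ≤ d)
    (hd1' : 1 ≤ d') (hd : d ≤ n) (hd' : d' ≤ n) (hdd : d ≤ d')
    (U U' : Submodule ℂ (Fin (n + 1) → ℂ)) :
    extendSub hn hb hd1 hd U ≤ extendSub hn hb hd1' hd' U' ↔ U.map (pr n d d') ≤ U' := by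
  have hlow : coordSub {i : Fin (2 * n) | (i : ℕ) + 1 < d'} ≤ extendSub hn hb hd1' hd' U' := by
    rw [extendSub_eq]
    exact le_sup_left
  have hmem : ∀ v, embed hn b hd v ∈ extendSub hn hb hd1' hd' U' ↔ pr n d d' v ∈ U' := by
    intro v
    have hs := hlow (embed_sub_embed_pr (b := b) hn hd hd' hdd v)
    rw [← embed_mem_extendSub_iff hn hb hd1' hd',
      ← Submodule.add_mem_iff_right (y := embed hn b hd' (pr n d d' v)) _ hs, sub_add_cancel]
  rw [extendSub_eq hn hb hd1 hd, sup_le_iff, Submodule.map_le_iff_le_comap,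
    Submodule.map_le_iff_le_comap]
  constructor
  · exact fun h v hv => (hmem v).1 (h.2 hv)
  · refine fun h => ⟨le_trans (coordSub_mono.2 fun i hi => ?_) hlow, fun v hv => (hmem v).2 (h hv)⟩
    rw [Set.mem_ofPred_eq] at hi ⊢
    omega

/-- The form on `V` is the pairing of two dual copies of `V` in `W`. -/
theorem formW_embed (hn : 1 ≤ n) (hb : IsSymplecticV n b) {d d' : ℕ} (hd : d ≤ n) (hd' : d' ≤ n)
    (hdd : d + d' = n + 1) (u v : Fin (n + 1) → ℂ) :
    formW n (embed hn b hd' u) (embed hn b hd v) = b u v := by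
  have h : (formW n).compl₁₂ (embed hn b hd') (embed hn b hd) = b := by
    refine LinearMap.BilinForm.ext_basis (Pi.basisFun ℂ (Fin (n + 1))) fun j k => ?_
    rw [Pi.basisFun_apply, Pi.basisFun_apply, LinearMap.compl₁₂_apply, embed_single, embed_single,
      map_smul, map_smul, LinearMap.smul_apply, formW_single_right, smul_eq_mul, smul_eq_mul,
      Pi.single_apply]
    have hj := j.2
    have hk := k.2
    have ht := target_val hn hd' j
    have ht' := target_val hn hd k
    have h2 := (target hn hd k).2
    -- Because `d + d' = n + 1`, the two targets are dual in `W` exactly when the labels are dual in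
    -- `V`.
    have hiff : Fin.rev (target hn hd k) = target hn hd' j ↔
        (k : ℕ) + 1 = dualLabel n (j + 1) := by
      rw [Fin.ext_iff, Fin.val_rev, ht, ht', dualLabel]
      split_ifs <;> omega
    by_cases hjk : (k : ℕ) + 1 = dualLabel n (j + 1)
    · have hrev := hiff.2 hjk
      have hsum : (target hn hd k : ℕ) + target hn hd' j + 1 = 2 * n := by
        rw [← hrev, Fin.val_rev]
        omega
      have hkj : j = dualIndex hn k := by
        rw [eq_dualIndex_iff]
        revert hjk
        unfold dualLabel
        split_ifs <;> omega
      rw [if_pos hrev]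
      -- Exactly one of two dual indices is below `n`; its scalar carries the value of `b` and the
      -- other scalar is `1`. Skew symmetry of `b` reconciles the signs.
      by_cases hlt : (target hn hd k : ℕ) < n
      · have hk' : (target hn hd k : ℕ) = k := by
          rw [ht']
          split_ifs at ht' ⊢ <;> omega
        have e1 : scale hn b (target hn hd k) = b (Pi.single k 1) (Pi.single j 1) := by
          have hf : (⟨(target hn hd k : ℕ), hlt.trans n.lt_succ_self⟩ : Fin (n + 1)) = k :=
            Fin.ext hk'
          rw [scale, dif_pos hlt, hf, hkj]
        have e2 : scale hn b (target hn hd' j) = 1 := by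
          rw [scale, dif_neg (by omega)]
        rw [e1, e2, formSign, if_pos hlt]
        have := hb.alt.neg_eq (Pi.single k 1) (Pi.single j 1)
        rw [← this]
        ring
      · have hj' : (target hn hd' j : ℕ) = j := by
          rw [ht]
          split_ifs at ht ⊢ <;> omega
        have e1 : scale hn b (target hn hd' j) = b (Pi.single j 1) (Pi.single k 1) := by
          have hf : (⟨(target hn hd' j : ℕ), by omega⟩ : Fin (n + 1)) = j := Fin.ext hj'
          rw [scale, dif_pos (by omega), hf, ← (eq_dualIndex_iff hn j k).2 hjk]
        have e2 : scale hn b (target hn hd k) = 1 := by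
          rw [scale, dif_neg hlt]
        rw [e1, e2, formSign, if_neg hlt]
        ring
    · rw [if_neg (mt hiff.1 hjk), hb.dual j k hjk]
      ring
  exact congrArg (fun f : LinearMap.BilinForm ℂ (Fin (n + 1) → ℂ) => f u v) h

/-- `F_{d'-1}` is orthogonal to `F_{n+d}` and `F_{d-1}` to `F_{n+d'}`, so only the pairing of the
two copies of `V` contributes, and that is `b`. One inclusion follows, and dimensions agree. -/
theorem orthogonal_extendSub (hn : 1 ≤ n) (hb : IsSymplecticV n b) {d d' : ℕ} (hd1 : 1 ≤ d)
    (hd1' : 1 ≤ d') (hd : d ≤ n) (hd' : d' ≤ n) (hdd : d + d' = n + 1)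
    (U : Submodule ℂ (Fin (n + 1) → ℂ)) :
    (formW n).orthogonal (extendSub hn hb hd1' hd' U) =
      extendSub hn hb hd1 hd (b.orthogonal U) := by
  have hortho : ∀ (e e' : ℕ), e + e' = n + 1 → ∀ w ∈ coordSub {i : Fin (2 * n) | (i : ℕ) + 1 < e'},
      ∀ z ∈ coordSub {i : Fin (2 * n) | (i : ℕ) < n + e}, formW n w z = 0 := by
    intro e e' he w hw z hz
    have h : coordSub {i : Fin (2 * n) | (i : ℕ) < n + e} ≤
        (formW n).orthogonal (coordSub {i : Fin (2 * n) | (i : ℕ) + 1 < e'}) := by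
      rw [orthogonal_coordSub, coordSub_mono]
      intro i hi
      have := i.2
      simp only [Set.mem_ofPred_eq, Fin.val_rev] at hi ⊢
      omega
    exact h hz w hw
  symm
  apply Submodule.eq_of_le_of_finrank_eq
  · intro z hz w hw
    have hz2 := extendSub_le hn hb hd1 hd _ hz
    rw [extendSub_eq] at hz hw
    obtain ⟨c, hc, _, ⟨v, hv, rfl⟩, rfl⟩ := Submodule.mem_sup.1 hz
    obtain ⟨c', hc', _, ⟨u, hu, rfl⟩, rfl⟩ := Submodule.mem_sup.1 hw
    have hu2 : embed hn b hd' u ∈ coordSub {i : Fin (2 * n) | (i : ℕ) < n + d'} := fun i hi =>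
      embed_apply_eq_zero hn hd1' hd' u (Or.inr (by simpa using hi))
    have h1 := hortho d d' hdd c' hc' _ hz2
    have h2 := hortho d' d (by omega) c hc _ hu2
    have h3 : b u v = 0 := hv u hu
    rw [map_add (formW n) c', LinearMap.add_apply, h1, map_add, formW_neg _ c, h2,
      formW_embed hn hb hd hd' hdd, h3]
    ring
  · rw [finrank_extendSub, LinearMap.BilinForm.finrank_orthogonal hb.nondegenerate,
      LinearMap.BilinForm.finrank_orthogonal (formW_nondegenerate n), finrank_extendSub,
      Module.finrank_fin_fun, Module.finrank_fin_fun]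
    have h := Submodule.finrank_le U
    rw [Module.finrank_fin_fun] at h
    omega

theorem diagEntry_succ (t : SL n) (i : Fin (2 * n)) : diagEntry t ((i : ℕ) + 1) = t.1 i i := by
  rw [diagEntry, dif_pos ⟨by simp, by simp⟩]
  rfl

theorem torus_apply_single {t : SL n} (ht : t ∈ torus n) (i : Fin (2 * n)) :
    Matrix.toLin' t.1 (Pi.single i 1) = t.1 i i • Pi.single i (1 : ℂ) := by
  ext j
  rw [Matrix.toLin'_apply, Matrix.mulVec_single_one, Matrix.col_apply, Pi.smul_apply, smul_eq_mul]
  by_cases h : j = i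
  · subst h; simp
  · rw [ht j i h, Pi.single_eq_of_ne h, mul_zero]

theorem torusOnV_single (t : SL n) (d : ℕ) (k : Fin (n + 1)) :
    torusOnV t d (Pi.single k 1) =
      (if d ≤ (k : ℕ) + 1 then diagEntry t (k + 1) else diagEntry t (n + 1 + (k + 1))) •
        Pi.single k (1 : ℂ) := by
  ext l
  rw [torusOnV, Matrix.toLin'_apply, Matrix.mulVec_diagonal, Pi.smul_apply, smul_eq_mul]
  by_cases h : l = k
  · subst h; rfl
  · rw [Pi.single_eq_of_ne h, mul_zero, mul_zero]

/-- The weight of `f_k` in the copy at `d` is by definition that of its target. -/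
theorem torus_comp_embed (hn : 1 ≤ n) {d : ℕ} (hd : d ≤ n) {t : SL n} (ht : t ∈ torus n) :
    Matrix.toLin' t.1 ∘ₗ embed hn b hd = embed hn b hd ∘ₗ torusOnV t d := by
  refine (Pi.basisFun ℂ (Fin (n + 1))).ext fun k => ?_
  rw [Pi.basisFun_apply, LinearMap.comp_apply, LinearMap.comp_apply, torusOnV_single, map_smul,
    embed_single, map_smul, torus_apply_single ht, smul_comm]
  congr 1
  rw [← diagEntry_succ, target_val]
  split_ifs <;> rfl

theorem map_torus_extendSub (hn : 1 ≤ n) (hb : IsSymplecticV n b) {d : ℕ} (hd1 : 1 ≤ d)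
    (hd : d ≤ n) {t : SL n} (ht : t ∈ torus n) (U : Submodule ℂ (Fin (n + 1) → ℂ)) :
    extendSub hn hb hd1 hd (U.map (torusOnV t d)) =
      (extendSub hn hb hd1 hd U).map (Matrix.toLin' t.1) := by
  have hlow : (coordSub {i : Fin (2 * n) | (i : ℕ) + 1 < d}).map (Matrix.toLin' t.1) =
      coordSub {i : Fin (2 * n) | (i : ℕ) + 1 < d} := by
    apply Submodule.eq_of_le_of_finrank_eq
    · rw [Submodule.map_le_iff_le_comap]
      refine coordSub_le_iff.2 fun i hi => ?_
      rw [Submodule.mem_comap, torus_apply_single ht]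
      exact Submodule.smul_mem _ _ (single_mem_coordSub.2 hi)
    · exact (Submodule.equivMapOfInjective _ (toLin'_SL_injective t) _).finrank_eq.symm
  rw [extendSub_eq, extendSub_eq, Submodule.map_sup, hlow, ← Submodule.map_comp,
    ← Submodule.map_comp, torus_comp_embed hn hd ht]

end Embedding

/-! ### The isomorphism -/

theorem monotone_of_succ {α : Type*} [Preorder α] {s : ℕ} {f : Fin s → α}
    (h : ∀ l l' : Fin s, (l : ℕ) + 1 = l' → f l ≤ f l') : Monotone f := by
  have key : ∀ (k : ℕ) (l l' : Fin s), (l : ℕ) + k = l' → f l ≤ f l' := by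
    intro k
    induction k with
    | zero => exact fun l l' hl => (congrArg f (Fin.ext hl)).le
    | succ k ih =>
      intro l l' hl
      have := l'.2
      exact (ih l ⟨l + k, by omega⟩ rfl).trans (h _ l' (by simp only; omega))
  intro l l' hl
  exact key (l' - l) l l' (by rw [Fin.le_def] at hl; omega)

/-- The partner map reverses order, so followed by `Fin.rev` it is a strictly increasing self-map of
`Fin s`, that is, the identity. -/
theorem add_rev_eq {s N : ℕ} {d : Fin s → ℕ} (hmono : StrictMono d)
    (hsym : ∀ i, ∃ j, d i + d j = N) (l : Fin s) : d l + d (Fin.rev l) = N := by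
  choose f hf using hsym
  have hg : StrictMono fun l => Fin.rev (f l) := by
    intro i j hij
    have h1 := hmono hij
    have h2 := hf i
    have h3 := hf j
    exact Fin.rev_lt_rev.2 (hmono.lt_iff_lt.1 (by omega))
  have h : Fin.rev (f l) = l := le_antisymm hg.apply_le hg.le_apply
  rw [← hf l, ← h, Fin.rev_rev, h]

section Isomorphism

variable {n s : ℕ} {b : LinearMap.BilinForm ℂ (Fin (n + 1) → ℂ)} {d : Fin s → ℕ}

theorem isZariskiClosed_spDegFlag (hb : IsSymplecticV n b)
    (hsym : ∀ l, d l + d (Fin.rev l) = n + 1) : IsZariskiClosed d (spDegFlag n b d) := by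
  refine Set.Subset.antisymm (fun x hx => ?_) (subset_zariskiClosure fun x hx => hx.1.1)
  have hι : iota b x = x := by
    refine iota_eq_self_of_isotropic hb.nondegenerate hsym hx.1
      fun l => bilin_eq_zero_of_mem_zariskiClosure b _ _ (fun y hy u hu v hv => ?_) hx
    rw [← congrFun hy.2 l] at hv
    exact hv u hu
  refine ⟨⟨hx.1, fun l l' hll' => ?_⟩, hι⟩
  rintro _ ⟨v, hv, rfl⟩
  rw [← congrFun hι l']
  intro u hu
  -- The containment of `pr (x l)` in `x l'` is orthogonality of `x (rev l')` and `x l` for the form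
  -- `(u, v) ↦ b u (pr v)`.
  refine bilin_eq_zero_of_mem_zariskiClosure (b.compl₂ (pr n (d l) (d l'))) (Fin.rev l') l
    (fun y hy u hu v hv => ?_) hx u hu v hv
  have hv' := hy.1.2 l l' hll' (Submodule.mem_map_of_mem hv)
  rw [← congrFun hy.2 l'] at hv'
  exact hv' u hu

/-- The map `ζ` on tuples of subspaces. -/
def extendTuple (hn : 1 ≤ n) (hb : IsSymplecticV n b) (hd : ∀ l, 1 ≤ d l ∧ d l ≤ n)
    (x : Tuple s (n + 1)) : Tuple s (2 * n) :=
  fun l => extendSub hn hb (hd l).1 (hd l).2 (x l)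

theorem extendTuple_injective (hn : 1 ≤ n) (hb : IsSymplecticV n b)
    (hd : ∀ l, 1 ≤ d l ∧ d l ≤ n) : Function.Injective (extendTuple (s := s) hn hb hd) :=
  fun _ _ h => funext fun l => (splitting hn hb (hd l).1 (hd l).2).extend_injective (congrFun h l)

/-- The conditions correspond one by one: dimensions, the projection conditions and containments,
the two involutions. The upper bound holds for every extended tuple. -/
theorem extendTuple_mem_iff (hn : 1 ≤ n) (hb : IsSymplecticV n b) (hmono : StrictMono d)
    (hd : ∀ l, 1 ≤ d l ∧ d l ≤ n) (hsym : ∀ l, d l + d (Fin.rev l) = n + 1)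
    (x : Tuple s (n + 1)) :
    extendTuple hn hb hd x ∈ boundedFlags n d ↔ x ∈ spDegFlag n b d := by
  have h1 : extendTuple hn hb hd x ∈ multiGr (2 * n) (flagDim d) ↔ x ∈ multiGr (n + 1) d := by
    refine forall_congr' fun l => ?_
    rw [extendTuple, finrank_extendSub, flagDim]
    have := hd l
    omega
  have h2 : Monotone (extendTuple hn hb hd x) ↔
      ∀ l l' : Fin s, (l : ℕ) + 1 = l' → (x l).map (pr n (d l) (d l')) ≤ x l' := by
    have h : ∀ l l' : Fin s, (l : ℕ) + 1 = l' → (extendTuple hn hb hd x l ≤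
        extendTuple hn hb hd x l' ↔ (x l).map (pr n (d l) (d l')) ≤ x l') := fun l l' hll' =>
      extendSub_le_extendSub_iff hn hb _ _ _ _
        (hmono.monotone (show l ≤ l' by rw [Fin.le_def]; omega)) _ _
    constructor
    · exact fun hx l l' hll' => (h l l' hll').1 (hx (by rw [Fin.le_def]; omega))
    · exact fun hx => monotone_of_succ fun l l' hll' => (h l l' hll').2 (hx l l' hll')
  have h3 : iota (formW n) (extendTuple hn hb hd x) = extendTuple hn hb hd x ↔ iota b x = x := by
    have h : iota (formW n) (extendTuple hn hb hd x) = extendTuple hn hb hd (iota b x) := by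
      ext1 l
      exact orthogonal_extendSub hn hb _ _ _ _ (hsym l) _
    rw [h]
    exact (extendTuple_injective hn hb hd).eq_iff
  have h4 : ∀ l, extendTuple hn hb hd x l ≤ coordSub {i | (i : ℕ) < n + d l} := fun l =>
    extendSub_le hn hb _ _ _
  constructor
  · exact fun ⟨hx1, hx2, _, hx4⟩ => ⟨⟨h1.1 hx1, h2.1 hx2⟩, h3.1 hx4⟩
  · exact fun ⟨⟨hx1, hx2⟩, hx3⟩ => ⟨h1.2 hx1, h2.2 hx2, h4, h3.2 hx3⟩

/-- The left inverse of `extendTuple`. -/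
def restrictTuple (hn : 1 ≤ n) (hb : IsSymplecticV n b) (hd : ∀ l, 1 ≤ d l ∧ d l ≤ n)
    (y : Tuple s (2 * n)) : Tuple s (n + 1) :=
  fun l => (y l).map (splitting hn hb (hd l).1 (hd l).2).ψ

theorem restrictTuple_extendTuple (hn : 1 ≤ n) (hb : IsSymplecticV n b)
    (hd : ∀ l, 1 ≤ d l ∧ d l ≤ n) (x : Tuple s (n + 1)) :
    restrictTuple hn hb hd (extendTuple hn hb hd x) = x :=
  funext fun _ => Splitting.map_ψ_extend _ _

theorem extendTuple_restrictTuple (hn : 1 ≤ n) (hb : IsSymplecticV n b)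
    (hd : ∀ l, 1 ≤ d l ∧ d l ≤ n) (hsym : ∀ l, d l + d (Fin.rev l) = n + 1)
    {y : Tuple s (2 * n)} (hy : y ∈ boundedFlags n d) :
    extendTuple hn hb hd (restrictTuple hn hb hd y) = y :=
  funext fun l => exists_eq_extendSub hn hb _ _ (le_of_mem_boundedFlags hsym hy l) (hy.2.2.1 l)

/-- The isomorphism `ζ` on points. -/
def zeta (hn : 1 ≤ n) (hb : IsSymplecticV n b) (hmono : StrictMono d)
    (hd : ∀ l, 1 ≤ d l ∧ d l ≤ n) (hsym : ∀ l, d l + d (Fin.rev l) = n + 1) :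
    spDegFlag n b d ≃ boundedFlags n d where
  toFun x := ⟨extendTuple hn hb hd x.1, (extendTuple_mem_iff hn hb hmono hd hsym _).2 x.2⟩
  invFun y := ⟨restrictTuple hn hb hd y.1, by
    rw [← extendTuple_mem_iff hn hb hmono hd hsym, extendTuple_restrictTuple hn hb hd hsym y.2]
    exact y.2⟩
  left_inv x := Subtype.ext (restrictTuple_extendTuple hn hb hd x.1)
  right_inv y := Subtype.ext (extendTuple_restrictTuple hn hb hd hsym y.2)

theorem isVarietyIso_zeta (hn : 1 ≤ n) (hb : IsSymplecticV n b) (hmono : StrictMono d)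
    (hd : ∀ l, 1 ≤ d l ∧ d l ≤ n) (hsym : ∀ l, d l + d (Fin.rev l) = n + 1) :
    IsVarietyIso d (flagDim d) (zeta hn hb hmono hd hsym) := by
  have hdim : ∀ l, d l - 1 + d l = flagDim d l := fun l => by
    have := (hd l).1
    rw [flagDim]
    omega
  constructor
  · refine isRegularMap_of_forms (fun x hx => hx.1.1) fun l => ?_
    obtain ⟨F, hF, hφ⟩ := (splitting hn hb (hd l).1 (hd l).2).exists_forms_extend d l (hdim l)
    exact ⟨_, F, hF, fun y p hp => hφ y.1 p hp⟩
  · refine isRegularMap_of_forms (fun y hy => hy.1) fun l => ?_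
    obtain ⟨F, hF, hφ⟩ := (splitting hn hb (hd l).1 (hd l).2).exists_forms_of_extend (flagDim d) l
      (hdim l)
    exact ⟨_, F, hF, fun y p hp => hφ y.1 p hp _ (((zeta hn hb hmono hd hsym).symm y).2.1.1 l)
      (congrFun (extendTuple_restrictTuple hn hb hd hsym y.2) l)⟩

theorem extendTuple_torusAct (hn : 1 ≤ n) (hb : IsSymplecticV n b)
    (hd : ∀ l, 1 ≤ d l ∧ d l ≤ n) {t : SL n} (ht : t ∈ torus n) (x : Tuple s (n + 1)) :
    extendTuple hn hb hd (torusAct d t x) = act t (extendTuple hn hb hd x) :=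
  funext fun _ => map_torus_extendSub hn hb _ _ ht _

theorem torus_subset_borel (n : ℕ) : torus n ⊆ borel n := fun _ ht i j hij => ht i j hij.ne'

end Isomorphism

end DegFlag

end

theorem theorem4p3 (m n s : ℕ) (hm : 1 ≤ m) (hn : n = 2 * m - 1)
    (b : LinearMap.BilinForm ℂ (Fin (n + 1) → ℂ)) (hb : DegFlag.IsSymplecticV n b)
    (d : Fin s → ℕ) (hmono : StrictMono d) (hd : ∀ i, 1 ≤ d i ∧ d i ≤ 2 * m)
    (hsym : ∀ i, ∃ j, d i + d j = 2 * m) :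
    -- both sides are projective varieties
    DegFlag.IsZariskiClosed d (DegFlag.spDegFlag n b d) ∧
    DegFlag.IsZariskiClosed (DegFlag.flagDim d)
      (DegFlag.schubertFixed n d (DegFlag.sigma n d)) ∧
    -- the fixed locus is a Schubert variety of `Sp_{2n} / Q`
    DegFlag.schubertFixed n d (DegFlag.sigma n d) =
      DegFlag.schubertSp n d (DegFlag.sigma n d) ∧
    -- and it is isomorphic, equivariantly under `T^ι`, to the degenerate flag variety
    ∃ ζ : DegFlag.spDegFlag n b d ≃ DegFlag.schubertFixed n d (DegFlag.sigma n d),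
      DegFlag.IsVarietyIso d (DegFlag.flagDim d) ζ ∧
      ∀ t ∈ DegFlag.torus n ∩ DegFlag.symplectic n, ∀ x : DegFlag.spDegFlag n b d,
        ∃ h : DegFlag.torusAct d t x.1 ∈ DegFlag.spDegFlag n b d,
          (ζ ⟨DegFlag.torusAct d t x.1, h⟩).1 = DegFlag.act t (ζ x).1 := by
  have hn1 : 1 ≤ n := by omega
  have hrev : ∀ l, d l + d (Fin.rev l) = n + 1 := fun l => by
    rw [DegFlag.add_rev_eq hmono hsym l]
    omega
  -- Here `n + 1 = 2 * m`; the value `2 * m` is excluded because its partner would be `0`.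
  have hdn : ∀ l, 1 ≤ d l ∧ d l ≤ n := fun l => by
    have := hrev l
    have := (hd l).1
    have := (hd (Fin.rev l)).1
    omega
  rw [DegFlag.schubertSp_eq_boundedFlags hmono hdn hrev,
    DegFlag.schubertFixed_eq_boundedFlags hmono hdn hrev]
  refine ⟨DegFlag.isZariskiClosed_spDegFlag hb hrev,
    DegFlag.isZariskiClosed_boundedFlags hrev fun l => (hdn l).1, rfl,
    DegFlag.zeta hn1 hb hmono hdn hrev, DegFlag.isVarietyIso_zeta hn1 hb hmono hdn hrev,
    fun t ht x => ?_⟩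
  have hact := DegFlag.extendTuple_torusAct hn1 hb hdn ht.1 x.1
  refine ⟨?_, hact⟩
  rw [← DegFlag.extendTuple_mem_iff hn1 hb hmono hdn hrev, hact]
  exact DegFlag.act_mem_boundedFlags ⟨DegFlag.torus_subset_borel n ht.1, ht.2⟩
    (DegFlag.zeta hn1 hb hmono hdn hrev x).2
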